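/- Let $R$ be a field of characteristic $0$ and let $d\ge 0$ be an integer. **Diagrams.** A trivalent diagram is a finite connected graph $D$ (multiple edges allowed) with an embedded oriented circle $S^1\subset D$, all of whose vertices are trivalent, together with a cyclic order of the three edges at each vertex not on $S^1$; diagrams are considered up to homeomorphisms preserving these data. Its degree is half the number of its vertices, and it is a chord diagram if all its vertices lie on $S^1$. Let $A=\bigoplus_d A_d$ be the graded $R$-vector space generated by trivalent diagrams modulo the (STU)-relations $S=T-U$. Here $S$ has an edge joining a vertex $x$ on the circle to a vertex $v$ off the circle, and the edges at $v$, in cyclic order, are this edge, $h_1,h_2$. The diagrams $T$ and $U$ arise from $S$ by deleting $v$, $x$ and this edge and attaching the free ends of $h_1,h_2$ to two consecutive points on the circle at the place of $x$: along the orientation of the circle, $h_2$ comes first and $h_1$ second in $T$, while $h_1$ comes first and $h_2$ second in $U$. A weight system of degree $d$ is a linear map $A_d\to R$. **Chromatic weight systems.** Let $\mathcal C$ be the $R$-vector space generated by (isomorphism classes of) finite simple graphs whose vertices carry positive integral weights, modulo the relations $G=G'_e-G''_e$ for all edges $e$ of $G$. Here $G'_e$ is $G$ with the edge $e$ removed,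 and $G''_e$ is obtained from $G'_e$ by merging the two ends of $e$ into one vertex whose weight is the sum of their weights and replacing multiple edges by single ones. The intersection graph $\Gamma(D)$ of a chord diagram $D$ has the chords of $D$ as vertices, all of weight $1$; two of them are adjacent if the endpoints of the two chords alternate on the circle. A weight system $w$ of degree $d$ is called chromatic if it factors through the linear map $\overline\Gamma:A\to\mathcal C$, $D\mapsto\Gamma(D)$ for chord diagrams $D$; that is, if there is a linear map $f:\mathcal C\to R$ with $w(D)=f(\Gamma(D))$ for all chord diagrams $D$ of degree $d$. **Weight systems from Lie algebras.** Let $\mathfrak g$ be a finite-dimensional Lie algebra over $R$, and let $\omega=\sum_i e_i\otimes e'_i$ be a Casimir element of $\mathfrak g$, that is, $(e_i)$ and $(e'_i)$ are dual bases of $\mathfrak g$ with respect to a non-degenerate symmetric $\mathrm{ad}$-invariant bilinear form. Let $\rho:\mathfrak g\to\mathrm{End}(M)$ be a finite-dimensional representation. The weight system $W_{\mathfrak g,\omega,\rho}$ is determined by its values on chord diagrams $D$: place a copy of $\omega$ on each chord, one tensor factor at each end, apply $\rho$, compose the resulting endomorphisms of $M$ in their order along the circle, and take the trace (so the value is $\dim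 M$ if $D$ has no chords). **Theorem.** Every chromatic weight system of degree $d$ is a finite $R$-linear combination of restrictions to $A_d$ of weight systems $W_{\mathfrak{gl}_n^{\oplus d},\,\omega,\,\tau^{\otimes d}}$. It is also a finite $R$-linear combination of restrictions to $A_d$ of weight systems $W_{\mathfrak{so}_n^{\oplus d},\,\omega,\,\tau^{\otimes d}}$. In both cases $n\ge 1$ and the Casimir element $\omega$ vary from term to term, $\tau$ is the defining representation on $R^n$, $\mathfrak{so}_n$ is the Lie algebra of skew-symmetric $n\times n$ matrices over $R$, and in $\tau^{\otimes d}$ the $i$-th summand of the direct sum acts on the $i$-th factor of $(R^n)^{\otimes d}$. -/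

import Mathlib

open scoped TensorProduct DirectSum

attribute [local instance 100] LieRing.ofAssociativeRing

noncomputable section

/-! ### Trivalent diagrams and the space `A` -/

/-- The half-edges (away from the oriented circle) of a trivalent diagram with `k` vertices on the
circle and `m` vertices outside of it: one half-edge at each circle vertex, three half-edges at
each other vertex. -/
abbrev HalfEdge (k m : ℕ) : Type := Fin k ⊕ (Fin m × Fin 3)

/-- The connected piece a half-edge starts from: `none` stands for the circle,
`some v` for the vertex `v` outside of the circle. -/
def HalfEdge.origin {k m : ℕ} : HalfEdge k m → Option (Fin m)
  | Sum.inl _ => none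
  | Sum.inr p => some p.1

/-- A (labelled) connected trivalent diagram. The `k` vertices on the oriented circle are numbered
`0, …, k - 1` as they are met on one turn along the circle, and at each of the `m` vertices
outside of the circle the three half-edges are numbered `0, 1, 2` following the cyclic order. The
edges outside of the circle are given by the fixed-point free involution `glue` of the
half-edges. -/
structure TrivalentDiagram (k m : ℕ) where
  glue : HalfEdge k m → HalfEdge k m
  glue_glue : ∀ h, glue (glue h) = h
  glue_ne : ∀ h, glue h ≠ h
  connected : (SimpleGraph.fromRel fun x y : Option (Fin m) =>
    ∃ h, HalfEdge.origin h = x ∧ HalfEdge.origin (glue h) = y).Connected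

/-- The relabelling of half-edges given by a rotation of the circle, a bijection of
the vertices outside of the circle and rotations of the cyclic orders at these vertices. -/
def HalfEdge.relabel {k m : ℕ} (r : ℕ) (e : Equiv.Perm (Fin m)) (s : Fin m → Fin 3) :
    HalfEdge k m → HalfEdge k m
  | Sum.inl i => Sum.inl ((finRotate k ^ r) i)
  | Sum.inr p => Sum.inr (e p.1, p.2 + s p.1)

/-- Equivalence of labelled diagrams: a homeomorphism that respects the oriented circle and the
cyclic orders. -/
def TrivalentDiagram.Equivalent {k m : ℕ} (D D' : TrivalentDiagram k m) : Prop :=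
  ∃ (r : ℕ) (e : Equiv.Perm (Fin m)) (s : Fin m → Fin 3),
    ∀ h, D'.glue (HalfEdge.relabel r e s h) = HalfEdge.relabel r e s (D.glue h)

/-- Identification of half-edges for the (STU)-relation. The last vertex outside of the circle,
together with the last circle vertex, is replaced by two consecutive circle vertices, the first of
which takes over the half-edge `a` of the removed vertex and the second of which takes over its
half-edge `b`. -/
def HalfEdge.resolve {k m : ℕ} (a b : Fin 3) : HalfEdge (k + 2) m → HalfEdge (k + 1) (m + 1)
  | Sum.inl i =>
      Fin.lastCases (motive := fun _ => HalfEdge (k + 1) (m + 1)) (Sum.inr (Fin.last m, b))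
        (fun i' => Fin.lastCases (motive := fun _ => HalfEdge (k + 1) (m + 1))
          (Sum.inr (Fin.last m, a)) (fun j => Sum.inl j.castSucc) i') i
  | Sum.inr p => Sum.inr (p.1.castSucc, p.2)

/-- `S`, `T`, `U` are related as the three diagrams in the relation (STU) `S = T - U`. In `S` the
last circle vertex is joined to half-edge `0` of the last vertex outside of the circle. Let `1`,
`2` be the further half-edges at that vertex in cyclic order. In `T` the edge of half-edge `2`
ends at the first and that of half-edge `1` at the second of the two new circle vertices; in `U`
it is the other way round. The rest of the three diagrams is the same. -/
def TrivalentDiagram.STU {k m : ℕ} (S : TrivalentDiagram (k + 1) (m + 1))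
    (T U : TrivalentDiagram (k + 2) m) : Prop :=
  S.glue (Sum.inl (Fin.last k)) = Sum.inr (Fin.last m, 0) ∧
  (∀ h, S.glue (HalfEdge.resolve 2 1 h) = HalfEdge.resolve 2 1 (T.glue h)) ∧
  (∀ h, S.glue (HalfEdge.resolve 1 2 h) = HalfEdge.resolve 1 2 (U.glue h))

/-- All labelled trivalent diagrams. -/
abbrev AnyDiagram : Type := Σ k m : ℕ, TrivalentDiagram k m

/-- The generator given by a labelled diagram. -/
def diagramGenerator (R : Type*) [Field R] {k m : ℕ} (D : TrivalentDiagram k m) :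
    AnyDiagram →₀ R :=
  Finsupp.single ⟨k, m, D⟩ 1

/-- Equivalent diagrams are identified, and the (STU)-relation is imposed. -/
inductive DiagramRelation (R : Type*) [Field R] : (AnyDiagram →₀ R) → Prop
  | equivalent {k m : ℕ} (D D' : TrivalentDiagram k m) (h : D.Equivalent D') :
      DiagramRelation R (diagramGenerator R D - diagramGenerator R D')
  | stu {k m : ℕ} (S : TrivalentDiagram (k + 1) (m + 1)) (T U : TrivalentDiagram (k + 2) m)
      (h : TrivalentDiagram.STU S T U) :
      DiagramRelation R
        (diagramGenerator R S - (diagramGenerator R T - diagramGenerator R U))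

/-- The vector space `A` of trivalent diagrams modulo (STU). -/
abbrev DiagramSpace (R : Type*) [Field R] : Type _ :=
  (AnyDiagram →₀ R) ⧸ Submodule.span R {x | DiagramRelation R x}

/-- The class of a trivalent diagram in `A`. -/
def TrivalentDiagram.toA (R : Type*) [Field R] {k m : ℕ} (D : TrivalentDiagram k m) :
    DiagramSpace R :=
  Submodule.Quotient.mk (diagramGenerator R D)

/-- The homogeneous part `A_d`. The degree of a diagram is half the number of its vertices. -/
def homogeneousPart (R : Type*) [Field R] (d : ℕ) : Submodule R (DiagramSpace R) :=
  Submodule.span R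
    {x | ∃ (k m : ℕ) (D : TrivalentDiagram k m), k + m = 2 * d ∧ x = D.toA R}

/-- The weight systems of degree `d`: linear forms on `A_d`. -/
abbrev WeightSystem (R : Type*) [Field R] (d : ℕ) : Type _ :=
  Module.Dual R (homogeneousPart R d)

/-! ### Chord diagrams -/

/-- A chord diagram of degree `d`, with its `2 * d` chord ends numbered along the oriented circle
and given by the pairing of chord ends. -/
structure ChordDiagram (d : ℕ) where
  partner : Fin (2 * d) → Fin (2 * d)
  partner_partner : ∀ i, partner (partner i) = i
  partner_ne : ∀ i, partner i ≠ i

/-- A chord diagram is a trivalent diagram without vertices outside of the circle. -/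
def ChordDiagram.toTrivalent {d : ℕ} (D : ChordDiagram d) : TrivalentDiagram (2 * d) 0 where
  glue
    | Sum.inl i => Sum.inl (D.partner i)
    | Sum.inr p => Sum.inr p
  glue_glue
    | Sum.inl i => by simp [D.partner_partner]
    | Sum.inr p => p.1.elim0
  glue_ne
    | Sum.inl i => by simpa using D.partner_ne i
    | Sum.inr p => p.1.elim0
  connected :=
    { preconnected := fun x y => by
        have h : x = y := Subsingleton.elim x y
        subst h
        exact SimpleGraph.Reachable.refl x
      nonempty := ⟨none⟩ }

/-- The class of a chord diagram of degree `d` in `A_d`. -/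
def ChordDiagram.toA (R : Type*) [Field R] {d : ℕ} (D : ChordDiagram d) : homogeneousPart R d :=
  ⟨D.toTrivalent.toA R, Submodule.subset_span ⟨2 * d, 0, D.toTrivalent, rfl, rfl⟩⟩

/-- The chords, represented by their first ends. -/
abbrev ChordDiagram.Chord {d : ℕ} (D : ChordDiagram d) : Type :=
  {i : Fin (2 * d) // i < D.partner i}

/-- The chord that ends at `p`. -/
def ChordDiagram.chordAt {d : ℕ} (D : ChordDiagram d) (p : Fin (2 * d)) : D.Chord :=
  if h : p < D.partner p then ⟨p, h⟩
  else ⟨D.partner p, by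
    rw [D.partner_partner]; exact lt_of_le_of_ne (not_lt.mp h) (D.partner_ne p)⟩

/-- Two chords intersect if their ends alternate along the circle. -/
def ChordDiagram.Intersect {d : ℕ} (D : ChordDiagram d) (a b : D.Chord) : Prop :=
  (a.1 < b.1 ∧ b.1 < D.partner a.1 ∧ D.partner a.1 < D.partner b.1) ∨
  (b.1 < a.1 ∧ a.1 < D.partner b.1 ∧ D.partner b.1 < D.partner a.1)

/-- The intersection graph of a chord diagram. -/
def ChordDiagram.intersectionGraph {d : ℕ} (D : ChordDiagram d) : SimpleGraph D.Chord where
  Adj := D.Intersect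
  symm := ⟨fun _ _ h => Or.symm h⟩
  loopless := ⟨fun _ h => by
    rcases h with h | h <;> exact lt_irrefl _ h.1⟩

/-! ### The chromatic algebra -/

/-- A finite simple graph with positive integral weights on its vertices. -/
structure WeightedGraph where
  V : Type
  [fintype : Fintype V]
  graph : SimpleGraph V
  weight : V → ℕ+

/-- Isomorphism of weighted graphs. -/
def WeightedGraph.Isomorphic (G H : WeightedGraph) : Prop :=
  ∃ e : G.graph ≃g H.graph, ∀ v, H.weight (e v) = G.weight v

/-- Removal of the edge between `u` and `v`. -/
def WeightedGraph.deleteEdge (G : WeightedGraph) (u v : G.V) : WeightedGraph where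
  V := G.V
  fintype := G.fintype
  graph := G.graph.deleteEdges {s(u, v)}
  weight := G.weight

open Classical in
/-- Contraction of the edge between `u` and `v`: the vertex `v` is merged into `u`, which gets the
sum of both weights, and multiple edges are replaced by unique edges. -/
def WeightedGraph.contractEdge (G : WeightedGraph) (u v : G.V) : WeightedGraph where
  V := {x : G.V // x ≠ v}
  fintype := @Subtype.fintype G.V (fun x => x ≠ v) _ G.fintype
  graph := SimpleGraph.fromRel fun x y =>
    G.graph.Adj x.1 y.1 ∨ (x.1 = u ∧ G.graph.Adj v y.1)
  weight x := if x.1 = u then G.weight u + G.weight v else G.weight x.1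

/-- The generator given by a weighted graph. -/
def graphGenerator (R : Type*) [Field R] (G : WeightedGraph) : WeightedGraph →₀ R :=
  Finsupp.single G 1

/-- Isomorphic weighted graphs are identified, and the chromatic relation
`G = G'_e - G''_e` is imposed for every edge `e`. -/
inductive ChromaticRelation (R : Type*) [Field R] : (WeightedGraph →₀ R) → Prop
  | isomorphic (G H : WeightedGraph) (h : G.Isomorphic H) :
      ChromaticRelation R (graphGenerator R G - graphGenerator R H)
  | chromatic (G : WeightedGraph) (u v : G.V) (h : G.graph.Adj u v) :
      ChromaticRelation R (graphGenerator R G -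
        (graphGenerator R (G.deleteEdge u v) - graphGenerator R (G.contractEdge u v)))

/-- The vector space `C` of weighted graphs modulo the chromatic relations. -/
abbrev ChromaticSpace (R : Type*) [Field R] : Type _ :=
  (WeightedGraph →₀ R) ⧸ Submodule.span R {x | ChromaticRelation R x}

/-- The class of a weighted graph in `C`. -/
def WeightedGraph.toC (R : Type*) [Field R] (G : WeightedGraph) : ChromaticSpace R :=
  Submodule.Quotient.mk (graphGenerator R G)

/-- The intersection graph of a chord diagram with all weights equal to one. -/
def ChordDiagram.weightedGraph {d : ℕ} (D : ChordDiagram d) : WeightedGraph where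
  V := D.Chord
  fintype := inferInstance
  graph := D.intersectionGraph
  weight := fun _ => 1

/-- A weight system of degree `d` is chromatic if it factors through the map from `A` to `C` that
sends (the class of) a chord diagram to (the class of) its intersection graph. Chord diagrams
span `A_d`, hence the factorization is tested on them. -/
def IsChromatic {R : Type*} [Field R] {d : ℕ} (w : WeightSystem R d) : Prop :=
  ∃ f : ChromaticSpace R →ₗ[R] R, ∀ D : ChordDiagram d, w (D.toA R) = f (D.weightedGraph.toC R)

/-! ### Weight systems from Lie algebras -/

/-- A non-degenerate symmetric `ad`-invariant bilinear form on the Lie algebra `g`, with two bases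
`e` and `e'` dual to each other with respect to the form. The associated Casimir element is
`ω = ∑ i, e i ⊗ e' i`; it depends on the form only. -/
structure CasimirData (R g : Type*) [Field R] [LieRing g] [LieAlgebra R g]
    (ι : Type) [Fintype ι] [DecidableEq ι] where
  form : LinearMap.BilinForm R g
  symm : form.IsSymm
  invariant : ∀ x y z : g, form ⁅x, y⁆ z = form x ⁅y, z⁆
  nondegenerate : form.Nondegenerate
  e : Module.Basis ι R g
  e' : Module.Basis ι R g
  dual : ∀ i j, form (e' j) (e i) = if i = j then 1 else 0

/-- The value `W_{g, ω, ρ}(D)` on a chord diagram, where `ω = ∑ e_i ⊗ e'_i` is the Casimir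
element, with the tensor powers of `ω` expanded in the bases: `c` runs over all choices of a summand
of `ω` for every chord.
A copy of `ω` is placed on every chord (with its first tensor factor at the first end, which does
not matter because `ω` is symmetric), the representation `ρ` is applied, the resulting
endomorphisms are composed in their order along the circle, and the trace is taken. For the chord
diagram without chords this is the trace of the identity, i.e. the dimension of `M`. -/
def lieWeight {R g M : Type*} [Field R] [LieRing g] [LieAlgebra R g]
    [AddCommGroup M] [Module R M] {ι : Type} [Fintype ι] [DecidableEq ι]
    (C : CasimirData R g ι) (ρ : g →ₗ⁅R⁆ Module.End R M) {d : ℕ} (D : ChordDiagram d) : R :=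
  ∑ c : D.Chord → ι, LinearMap.trace R M
    (List.ofFn fun p : Fin (2 * d) =>
      ρ (if p < D.partner p then C.e (c (D.chordAt p)) else C.e' (c (D.chordAt p)))).prod

/-- `w` is the weight system of degree `d` associated with the Lie algebra `g`, some
Casimir element of `g` and the representation `ρ`. -/
def IsLieWeightSystem {R g M : Type*} [Field R] [LieRing g] [LieAlgebra R g]
    [AddCommGroup M] [Module R M] (ρ : g →ₗ⁅R⁆ Module.End R M) {d : ℕ}
    (w : WeightSystem R d) : Prop :=
  ∃ (ι : Type) (_ : Fintype ι) (_ : DecidableEq ι) (C : CasimirData R g ι),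
    ∀ D : ChordDiagram d, w (D.toA R) = lieWeight C ρ D

/-- The endomorphism of the `d`-th tensor power that applies `φ` to the `i`-th factor. -/
def applyFactor {R V : Type*} [Field R] [AddCommGroup V] [Module R V] {d : ℕ} (i : Fin d)
    (φ : Module.End R V) : Module.End R (⨂[R] _ : Fin d, V) :=
  PiTensorProduct.map (Function.update (fun _ => LinearMap.id) i φ)

theorem applyFactor_add {R V : Type*} [Field R] [AddCommGroup V] [Module R V] {d : ℕ} (i : Fin d)
    (φ ψ : Module.End R V) : applyFactor i (φ + ψ) = applyFactor i φ + applyFactor i ψ := by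
  unfold applyFactor
  exact PiTensorProduct.map_update_add (R := R) (s := fun _ : Fin d => V) (t := fun _ : Fin d => V)
    (fun _ => LinearMap.id) i φ ψ

theorem applyFactor_smul {R V : Type*} [Field R] [AddCommGroup V] [Module R V] {d : ℕ} (i : Fin d)
    (a : R) (φ : Module.End R V) : applyFactor i (a • φ) = a • applyFactor i φ := by
  unfold applyFactor
  exact PiTensorProduct.map_update_smul (R := R) (s := fun _ : Fin d => V)
    (t := fun _ : Fin d => V) (fun _ => LinearMap.id) i a φ

theorem applyFactor_mul {R V : Type*} [Field R] [AddCommGroup V] [Module R V] {d : ℕ} (i : Fin d)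
    (φ ψ : Module.End R V) : applyFactor i φ * applyFactor i ψ = applyFactor i (φ * ψ) := by
  unfold applyFactor
  rw [← PiTensorProduct.map_mul]
  congr 1
  funext k
  by_cases h : k = i
  · subst h; simp
  · simp only [Function.update_of_ne h]; rfl

theorem applyFactor_comm {R V : Type*} [Field R] [AddCommGroup V] [Module R V] {d : ℕ}
    {i j : Fin d} (hij : i ≠ j) (φ ψ : Module.End R V) :
    applyFactor i φ * applyFactor j ψ = applyFactor j ψ * applyFactor i φ := by
  unfold applyFactor
  rw [← PiTensorProduct.map_mul, ← PiTensorProduct.map_mul]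
  congr 1
  funext k
  by_cases h : k = i
  · subst h
    simp only [Function.update_self, Function.update_of_ne hij]; rfl
  · by_cases h' : k = j
    · subst h'
      simp only [Function.update_self, Function.update_of_ne h]; rfl
    · simp only [Function.update_of_ne h, Function.update_of_ne h']

/-- The representation of `g` on the `d`-th tensor power of `V` through the `i`-th factor. -/
def factorRep {R g V : Type*} [Field R] [LieRing g] [LieAlgebra R g]
    [AddCommGroup V] [Module R V] (τ : g →ₗ⁅R⁆ Module.End R V) {d : ℕ} (i : Fin d) :
    g →ₗ⁅R⁆ Module.End R (⨂[R] _ : Fin d, V) where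
  toFun x := applyFactor i (τ x)
  map_add' x y := by rw [map_add, applyFactor_add]
  map_smul' a x := by rw [map_smul, applyFactor_smul, RingHom.id_apply]
  map_lie' {x y} := by
    have hsub : ∀ φ ψ : Module.End R V,
        applyFactor i (φ - ψ) = applyFactor i φ - applyFactor i ψ := fun φ ψ => by
      rw [eq_sub_iff_add_eq, ← applyFactor_add, sub_add_cancel]
    change applyFactor i (τ ⁅x, y⁆) = ⁅applyFactor i (τ x), applyFactor i (τ y)⁆
    rw [LieHom.map_lie, LieRing.of_associative_ring_bracket, hsub,
      LieRing.of_associative_ring_bracket, applyFactor_mul, applyFactor_mul]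

/-- The representation of the direct sum `g ⊕ ⋯ ⊕ g` (`d` summands) on the `d`-th tensor power
of a representation `V` of `g`, where the `i`-th summand acts on the `i`-th tensor factor. -/
def tensorPowerRep {R g V : Type*} [Field R] [LieRing g] [LieAlgebra R g]
    [AddCommGroup V] [Module R V] (τ : g →ₗ⁅R⁆ Module.End R V) (d : ℕ) :
    (⨁ _ : Fin d, g) →ₗ⁅R⁆ Module.End R (⨂[R] _ : Fin d, V) :=
  DirectSum.toLieAlgebra (Module.End R (⨂[R] _ : Fin d, V)) (fun i => factorRep τ i)
    (fun i j hij x y => by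
      change ⁅applyFactor i (τ x), applyFactor j (τ y)⁆ = 0
      rw [LieRing.of_associative_ring_bracket, applyFactor_comm hij, sub_self])

/-- The defining representation of `gl_n`. -/
def glRep (R : Type*) [Field R] (n : ℕ) :
    Matrix (Fin n) (Fin n) R →ₗ⁅R⁆ Module.End R (Fin n → R) :=
  (lieEquivMatrix' (R := R) (n := Fin n)).symm

/-- The defining representation of `so_n`, the Lie algebra of skew-symmetric matrices. -/
def soRep (R : Type*) [Field R] (n : ℕ) :
    LieAlgebra.Orthogonal.so (Fin n) R →ₗ⁅R⁆ Module.End R (Fin n → R) :=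
  (glRep R n).comp (LieAlgebra.Orthogonal.so (Fin n) R).incl

end

/-!
Write `X_G(l) = ∑ c, ∏ v, (l (c v)) ^ weight v` for the weighted chromatic function of a graph `G`,
where `c` runs over the proper colourings with `d` colours and `l` is a tuple of `d` scalars.
The theorem combines two facts about it.

First, for nonzero `l`, the map `D ↦ X_{Γ(D)}(l)` is a linear combination of Lie algebra weight
systems. Take the Casimir element of `gl_n^{⊕ d}` or `so_n^{⊕ d}` that is `l i` times the standard
one on the `i`-th summand. The standard Casimir element of `gl_n` acts on `R^n ⊗ R^n` by the
permutation of the factors, and that of `so_n` by the permutation minus the contraction. So the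
weight of `D` is a sum over states, in which each chord chooses a tensor factor and one of these
two terms, and a state contributes its coefficient times `n ^ (number of closed index loops)`
(`lieWeight_eq_sum_states`). A labelling of the loops by bits is determined by its values at the
base point, one for each tensor factor, and by its jump at each chord. Hence there are at most
`2 * d` loops, and the jumps can be prescribed freely exactly if no chord is twisted and crossing
chords use different tensor factors (`ChordDiagram.loops_eq_iff`). The coefficient of `n ^ (2 * d)`
therefore counts the proper colourings of `Γ(D)`, with weights `l`, and this coefficient is a linear
combination of the values at `n = 1, …, 2 * d + 1` (`exists_mem_span_chromaticValue`).

Second, on graphs of total weight `d`, each linear form `f` on the space of graphs is a linear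
combination of functions `G ↦ X_G(l)` with nonzero `l`
(`WeightedGraph.exists_eq_sum_chromaticValue`). By deletion and contraction it suffices to
consider graphs without edges. They correspond to the partitions of `d`, and `X` takes them to
products of power sums. These are linearly independent in `d` variables
(`psumPart_linearIndependent`), so that the values at points with nonzero coordinates span the dual.

Two facts link chord diagrams to weight systems. The Lie algebra weight of chord diagrams
extends to a linear form on `A_d`, through a state sum for all trivalent diagrams that respects
(STU) (`exists_weightSystem_lieWeight`), and a weight system is determined by its values on chord diagrams
(`weightSystem_ext`).
-/

/-! ### Weight systems from metric Lie algebras -/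

noncomputable section StateSum

variable {R g M : Type*} [Field R] [LieRing g] [LieAlgebra R g] [AddCommGroup M] [Module R M]
  {ι : Type} [Fintype ι] [DecidableEq ι]

/-- The edges of a pairing `glue`, as unordered pairs. -/
def pairingEdges {H : Type*} [Fintype H] [DecidableEq H] (glue : H → H) : Finset (Sym2 H) :=
  Finset.univ.image fun h => s(h, glue h)

theorem pairingEdges_conj {H H' : Type*} [Fintype H] [DecidableEq H] [Fintype H'] [DecidableEq H']
    (φ : H ≃ H') {glue : H → H} {glue' : H' → H'} (hφ : ∀ h, glue' (φ h) = φ (glue h)) :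
    pairingEdges glue' = (pairingEdges glue).image (Sym2.map φ) := by
  ext z
  simp only [pairingEdges, Finset.mem_image, Finset.mem_univ, true_and]
  constructor
  · rintro ⟨h, rfl⟩
    refine ⟨_, ⟨φ.symm h, rfl⟩, ?_⟩
    rw [Sym2.map_mk, ← hφ, φ.apply_symm_apply]
  · rintro ⟨_, ⟨h, rfl⟩, rfl⟩
    exact ⟨φ h, by rw [Sym2.map_mk, ← hφ]⟩

namespace CasimirData

/-- The coefficients of the Casimir element: `ω = ∑ i j, gram i j • e i ⊗ e j`. -/
def gram (C : CasimirData R g ι) (i j : ι) : R := C.form (C.e' i) (C.e' j)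

theorem gram_comm (C : CasimirData R g ι) (i j : ι) : C.gram i j = C.gram j i :=
  C.symm.eq _ _

theorem sum_form_smul (C : CasimirData R g ι) (z : g) :
    ∑ i, C.form (C.e' i) z • C.e i = z := by
  conv_rhs => rw [← C.e.sum_repr z]
  refine Finset.sum_congr rfl fun i _ => ?_
  congr 1
  conv_lhs => rw [← C.e.sum_repr z, map_sum]
  simp only [map_smul, C.dual, smul_eq_mul]
  simp

theorem dual_eq_sum_gram (C : CasimirData R g ι) (i : ι) :
    C.e' i = ∑ j, C.gram i j • C.e j := by
  conv_lhs => rw [← C.sum_form_smul (C.e' i)]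
  simp only [C.gram_comm i]
  rfl

/-- Contracting the Casimir element with the form is the identity. -/
theorem sum_gram_mul_form_smul (C : CasimirData R g ι) (z : g) :
    ∑ i, ∑ j, (C.gram i j * C.form (C.e j) z) • C.e i = z := by
  conv_rhs => rw [← C.sum_form_smul z]
  refine Finset.sum_congr rfl fun i _ => ?_
  rw [← Finset.sum_smul]
  conv_rhs => rw [C.dual_eq_sum_gram i]
  simp

/-- The factor of an edge in the state sum, for half-edges labelled by basis elements. -/
def edgeFactor (C : CasimirData R g ι) {H : Type*} (a : H → ι) : Sym2 H → R :=
  Sym2.lift ⟨fun x y => C.gram (a x) (a y), fun _ _ => C.gram_comm _ _⟩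

theorem edgeFactor_map (C : CasimirData R g ι) {H H' : Type*} (φ : H → H') (a : H' → ι)
    (z : Sym2 H) : C.edgeFactor a (z.map φ) = C.edgeFactor (a ∘ φ) z := by
  induction z with | _ x y => rfl

/-- The product of the edge factors of a pairing of the half-edges. -/
def edgeProd (C : CasimirData R g ι) {H : Type*} [Fintype H] [DecidableEq H] (glue : H → H)
    (a : H → ι) : R :=
  ∏ z ∈ pairingEdges glue, C.edgeFactor a z

theorem edgeProd_conj (C : CasimirData R g ι) {H H' : Type*} [Fintype H] [DecidableEq H]
    [Fintype H'] [DecidableEq H'] (φ : H ≃ H') {glue : H → H} {glue' : H' → H'}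
    (hφ : ∀ h, glue' (φ h) = φ (glue h)) (a : H' → ι) :
    C.edgeProd glue' a = C.edgeProd glue (a ∘ φ) := by
  rw [edgeProd, edgeProd, pairingEdges_conj φ hφ, Finset.prod_image]
  · exact Finset.prod_congr rfl fun z _ => C.edgeFactor_map φ a z
  · exact (Sym2.map.injective φ.injective).injOn

/-- The factor of a vertex outside of the circle in the state sum: the structure tensor
`⟨x₀, [x₂, x₁]⟩`. The order of the bracket is the one that matches the sign in (STU). -/
def vertexFactor (C : CasimirData R g ι) (u : Fin 3 → ι) : R :=
  C.form (C.e (u 0)) ⁅C.e (u 2), C.e (u 1)⁆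

theorem vertexFactor_rotate (C : CasimirData R g ι) (u : Fin 3 → ι) (s : Fin 3) :
    C.vertexFactor (fun i => u (i + s)) = C.vertexFactor u := by
  have key : ∀ x y z : g, C.form x ⁅z, y⁆ = C.form y ⁅x, z⁆ := fun x y z => by
    rw [← C.invariant]; exact C.symm.eq _ _
  fin_cases s
  · rfl
  · change C.form (C.e (u 1)) ⁅C.e (u 0), C.e (u 2)⁆ = C.form (C.e (u 0)) ⁅C.e (u 2), C.e (u 1)⁆
    rw [key (C.e (u 0))]
  · change C.form (C.e (u 2)) ⁅C.e (u 1), C.e (u 0)⁆ = C.form (C.e (u 0)) ⁅C.e (u 2), C.e (u 1)⁆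
    rw [key (C.e (u 2))]

end CasimirData

theorem trace_prod_ofFn_rotate {k : ℕ} (r : ℕ) (f : Fin k → Module.End R M) :
    LinearMap.trace R M (List.ofFn (f ∘ (finRotate k ^ r : Equiv.Perm (Fin k)))).prod =
      LinearMap.trace R M (List.ofFn f).prod := by
  induction r generalizing f with
  | zero => simp
  | succ r ih =>
    have h1 : f ∘ (finRotate k ^ (r + 1) : Equiv.Perm (Fin k)) =
        (f ∘ finRotate k) ∘ (finRotate k ^ r : Equiv.Perm (Fin k)) := by
      funext i; simp [pow_succ']
    rw [h1, ih]
    cases k with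
    | zero => simp
    | succ k =>
      conv_rhs => rw [List.ofFn_succ, List.prod_cons, LinearMap.trace_mul_comm]
      rw [List.ofFn_succ', List.concat_eq_append, List.prod_append, List.prod_singleton]
      simp only [Function.comp_apply, finRotate_last]
      congr 4
      funext i
      rw [finRotate_apply, Fin.coeSucc_eq_succ]

/-- The contribution of a labelling of the half-edges by basis elements to the weight of a
trivalent diagram. -/
def stateWeight (C : CasimirData R g ι) (ρ : g →ₗ⁅R⁆ Module.End R M) {k m : ℕ}
    (D : TrivalentDiagram k m) (a : HalfEdge k m → ι) : R :=
  C.edgeProd D.glue a * (∏ v : Fin m, C.vertexFactor fun i => a (Sum.inr (v, i))) *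
    LinearMap.trace R M (List.ofFn fun i : Fin k => ρ (C.e (a (Sum.inl i)))).prod

/-- The weight of a trivalent diagram: the Casimir element is placed on the edges, the
structure tensor at the vertices outside of the circle, and the trace is taken along the circle. -/
def trivalentWeight (C : CasimirData R g ι) (ρ : g →ₗ⁅R⁆ Module.End R M) {k m : ℕ}
    (D : TrivalentDiagram k m) : R :=
  ∑ a : HalfEdge k m → ι, stateWeight C ρ D a

theorem HalfEdge.relabel_bijective {k m : ℕ} (r : ℕ) (e : Equiv.Perm (Fin m))
    (s : Fin m → Fin 3) : Function.Bijective (HalfEdge.relabel (k := k) r e s) := by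
  rw [← Finite.injective_iff_bijective]
  rintro (i | ⟨v, i⟩) (j | ⟨w, j⟩) h
  · simpa [HalfEdge.relabel] using h
  · simp [HalfEdge.relabel] at h
  · simp [HalfEdge.relabel] at h
  · simp only [HalfEdge.relabel, Sum.inr.injEq, Prod.mk.injEq, EmbeddingLike.apply_eq_iff_eq] at h
    obtain ⟨rfl, h⟩ := h
    rw [add_right_cancel h]

/-- The weight does not depend on the labelling of the diagram: the vertex factors and the trace are
cyclically invariant, and the edge factors are symmetric. -/
theorem trivalentWeight_congr (C : CasimirData R g ι) (ρ : g →ₗ⁅R⁆ Module.End R M) {k m : ℕ}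
    {D D' : TrivalentDiagram k m} (h : D.Equivalent D') :
    trivalentWeight C ρ D = trivalentWeight C ρ D' := by
  obtain ⟨r, e, s, h⟩ := h
  let φ := Equiv.ofBijective _ (HalfEdge.relabel_bijective (k := k) r e s)
  symm
  refine Fintype.sum_equiv (φ.symm.arrowCongr (Equiv.refl ι)) _ _ fun a => ?_
  have hφ : (φ.symm.arrowCongr (Equiv.refl ι)) a = a ∘ φ := rfl
  rw [hφ, stateWeight, stateWeight, C.edgeProd_conj φ h]
  congr 1
  · congr 1
    rw [← Equiv.prod_comp e]
    refine Finset.prod_congr rfl fun v _ => ?_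
    exact (C.vertexFactor_rotate (fun i => a (Sum.inr (e v, i))) (s v)).symm
  · exact (trace_prod_ofFn_rotate r fun i => ρ (C.e (a (Sum.inl i)))).symm

/-- In the (STU)-relation, the half-edges of `S` are those of `T` together with the two halves of
the removed edge. -/
def stuEquiv (k m : ℕ) :
    HalfEdge (k + 2) m ⊕ Bool ≃ HalfEdge (k + 1) (m + 1) :=
  Equiv.ofBijective
    (Sum.elim (HalfEdge.resolve 2 1)
      fun b => if b then Sum.inl (Fin.last k) else Sum.inr (Fin.last m, 0)) <| by
    rw [Fintype.bijective_iff_surjective_and_card]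
    constructor
    · rintro (i | ⟨v, t⟩)
      · induction i using Fin.lastCases with
        | last => exact ⟨Sum.inr true, rfl⟩
        | cast i => exact ⟨Sum.inl (Sum.inl i.castSucc.castSucc), by simp [HalfEdge.resolve]⟩
      · induction v using Fin.lastCases with
        | last =>
          fin_cases t
          · exact ⟨Sum.inr false, rfl⟩
          · exact ⟨Sum.inl (Sum.inl (Fin.last _)), by simp [HalfEdge.resolve]⟩
          · exact ⟨Sum.inl (Sum.inl (Fin.last _).castSucc), by simp [HalfEdge.resolve]⟩
        | cast v => exact ⟨Sum.inl (Sum.inr (v, t)), rfl⟩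
    · simp; ring

theorem stuEquiv_inl {k m : ℕ} (h : HalfEdge (k + 2) m) :
    stuEquiv k m (Sum.inl h) = HalfEdge.resolve 2 1 h := rfl

theorem HalfEdge.resolve_injective {k m : ℕ} :
    Function.Injective (HalfEdge.resolve (k := k) (m := m) 2 1) := fun x y h => by
  rw [← stuEquiv_inl, ← stuEquiv_inl] at h
  exact Sum.inl_injective ((stuEquiv k m).injective h)

/-- The labelling of the half-edges of `S` that extends the labelling `b` of the half-edges of `T`
by the labels `i`, `j` of the two halves of the removed edge. -/
def stuLabelling {α : Type*} {k m : ℕ} (b : HalfEdge (k + 2) m → α) (i j : α) :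
    HalfEdge (k + 1) (m + 1) → α :=
  fun h => Sum.elim b (fun t => if t then i else j) ((stuEquiv k m).symm h)

theorem stuLabelling_resolve {α : Type*} {k m : ℕ} (b : HalfEdge (k + 2) m → α) (i j : α)
    (h : HalfEdge (k + 2) m) : stuLabelling b i j (HalfEdge.resolve 2 1 h) = b h := by
  rw [← stuEquiv_inl, stuLabelling, Equiv.symm_apply_apply, Sum.elim_inl]

theorem stuLabelling_circle {α : Type*} {k m : ℕ} (b : HalfEdge (k + 2) m → α) (i j : α) :
    stuLabelling b i j (Sum.inl (Fin.last k)) = i := by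
  rw [show Sum.inl (Fin.last k) = stuEquiv k m (Sum.inr true) from rfl, stuLabelling,
    Equiv.symm_apply_apply]
  rfl

theorem stuLabelling_vertex {α : Type*} {k m : ℕ} (b : HalfEdge (k + 2) m → α) (i j : α) :
    stuLabelling b i j (Sum.inr (Fin.last m, 0)) = j := by
  rw [show Sum.inr (Fin.last m, 0) = stuEquiv k m (Sum.inr false) from rfl, stuLabelling,
    Equiv.symm_apply_apply]
  rfl

theorem sum_stuLabelling {α : Type*} [Fintype α] {k m : ℕ}
    (F : (HalfEdge (k + 1) (m + 1) → α) → R) :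
    ∑ a, F a = ∑ b : HalfEdge (k + 2) m → α, ∑ i, ∑ j, F (stuLabelling b i j) := by
  simp_rw [← Fintype.sum_prod_type']
  symm
  refine Fintype.sum_equiv (((Equiv.refl _).prodCongr
    ((Equiv.boolArrowEquivProd α).trans (Equiv.prodComm α α)).symm).trans
      ((Equiv.sumArrowEquivProdArrow _ _ _).symm.trans
      ((stuEquiv k m).arrowCongr (Equiv.refl α)))) _ _ fun x => ?_
  congr 1

theorem pairingEdges_stu {k m : ℕ} {S : TrivalentDiagram (k + 1) (m + 1)}
    {T : TrivalentDiagram (k + 2) m}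
    (h0 : S.glue (Sum.inl (Fin.last k)) = Sum.inr (Fin.last m, 0))
    (hT : ∀ h, S.glue (HalfEdge.resolve 2 1 h) = HalfEdge.resolve 2 1 (T.glue h)) :
    pairingEdges S.glue = insert s(Sum.inl (Fin.last k), Sum.inr (Fin.last m, 0))
      ((pairingEdges T.glue).image (Sym2.map (HalfEdge.resolve 2 1))) := by
  have h0' : S.glue (Sum.inr (Fin.last m, 0)) = Sum.inl (Fin.last k) := by
    rw [← h0, S.glue_glue]
  ext z
  simp only [pairingEdges, Finset.mem_image, Finset.mem_univ, true_and, Finset.mem_insert]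
  constructor
  · rintro ⟨h, rfl⟩
    obtain ⟨h, rfl⟩ := (stuEquiv k m).surjective h
    rcases h with h | (_ | _)
    · right
      exact ⟨_, ⟨h, rfl⟩, by rw [stuEquiv_inl, hT, Sym2.map_mk]⟩
    · left
      change s(Sum.inr (Fin.last m, 0), S.glue (Sum.inr (Fin.last m, 0))) = _
      rw [h0', Sym2.eq_swap]
    · left
      change s(Sum.inl (Fin.last k), S.glue (Sum.inl (Fin.last k))) = _
      rw [h0]
  · rintro (rfl | ⟨_, ⟨h, rfl⟩, rfl⟩)
    · exact ⟨_, by rw [h0]⟩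
    · exact ⟨HalfEdge.resolve 2 1 h, by rw [hT, Sym2.map_mk]⟩

theorem edgeProd_stu (C : CasimirData R g ι) {k m : ℕ} {S : TrivalentDiagram (k + 1) (m + 1)}
    {T : TrivalentDiagram (k + 2) m}
    (h0 : S.glue (Sum.inl (Fin.last k)) = Sum.inr (Fin.last m, 0))
    (hT : ∀ h, S.glue (HalfEdge.resolve 2 1 h) = HalfEdge.resolve 2 1 (T.glue h))
    (b : HalfEdge (k + 2) m → ι) (i j : ι) :
    C.edgeProd S.glue (stuLabelling b i j) = C.gram i j * C.edgeProd T.glue b := by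
  rw [CasimirData.edgeProd, pairingEdges_stu h0 hT, Finset.prod_insert, Finset.prod_image]
  · congr 1
    · change C.gram _ _ = _
      rw [stuLabelling_circle, stuLabelling_vertex]
    · refine Finset.prod_congr rfl fun z _ => ?_
      rw [C.edgeFactor_map]
      congr 1
      funext h
      exact stuLabelling_resolve b i j h
  · exact (Sym2.map.injective HalfEdge.resolve_injective).injOn
  · intro hmem
    simp only [pairingEdges, Finset.mem_image, Finset.mem_univ, true_and] at hmem
    obtain ⟨_, ⟨h, rfl⟩, hz⟩ := hmem
    have hm : (Sum.inl (Fin.last k) : HalfEdge (k + 1) (m + 1)) ∈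
        Sym2.map (HalfEdge.resolve 2 1) s(h, T.glue h) := by
      rw [hz]; exact Sym2.mem_mk_left _ _
    rw [Sym2.mem_map] at hm
    obtain ⟨x, -, hx⟩ := hm
    have : stuEquiv k m (Sum.inl x) = stuEquiv k m (Sum.inr true) := hx
    exact absurd ((stuEquiv k m).injective this) (by simp)

/-- The exchange of the last two circle vertices, which relates `T` and `U` in (STU). -/
def stuSwap (k m : ℕ) : HalfEdge (k + 2) m ≃ HalfEdge (k + 2) m :=
  (Equiv.swap (Fin.last (k + 1)) (Fin.last k).castSucc).sumCongr (Equiv.refl _)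

theorem resolve_stuSwap {k m : ℕ} (h : HalfEdge (k + 2) m) :
    HalfEdge.resolve 2 1 (stuSwap k m h) = HalfEdge.resolve 1 2 h := by
  rcases h with i | p
  · induction i using Fin.lastCases with
    | last => simp [stuSwap, HalfEdge.resolve]
    | cast i =>
      induction i using Fin.lastCases with
      | last => simp [stuSwap, HalfEdge.resolve]
      | cast i =>
        have h1 : i.castSucc.castSucc ≠ Fin.last (k + 1) := Fin.castSucc_ne_last _
        have h2 : i.castSucc.castSucc ≠ (Fin.last k).castSucc := by
          rw [Ne, Fin.castSucc_inj]; exact Fin.castSucc_ne_last _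
        have h3 : stuSwap k m (Sum.inl i.castSucc.castSucc) = Sum.inl i.castSucc.castSucc :=
          congrArg Sum.inl (Equiv.swap_apply_of_ne_of_ne h1 h2)
        rw [h3]
        simp [HalfEdge.resolve]
  · rfl

/-- Contracting the Casimir element on the removed edge with the structure tensor turns the two
factors of `S` into the commutator of the factors at the two new circle vertices. -/
theorem trivalentWeight_stu (C : CasimirData R g ι) (ρ : g →ₗ⁅R⁆ Module.End R M) {k m : ℕ}
    {S : TrivalentDiagram (k + 1) (m + 1)} {T U : TrivalentDiagram (k + 2) m}
    (h : TrivalentDiagram.STU S T U) :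
    trivalentWeight C ρ S = trivalentWeight C ρ T - trivalentWeight C ρ U := by
  obtain ⟨h0, hT, hU⟩ := h
  have hTU : ∀ h, T.glue (stuSwap k m h) = stuSwap k m (U.glue h) := fun h =>
    HalfEdge.resolve_injective <| by
      rw [← hT, resolve_stuSwap, resolve_stuSwap, hU]
  have hUsum : trivalentWeight C ρ U =
      ∑ b : HalfEdge (k + 2) m → ι, stateWeight C ρ U (b ∘ stuSwap k m) :=
    (Fintype.sum_equiv ((stuSwap k m).symm.arrowCongr (Equiv.refl ι)) _ _ fun _ => rfl).symm
  rw [hUsum, trivalentWeight, trivalentWeight, sum_stuLabelling, ← Finset.sum_sub_distrib]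
  refine Finset.sum_congr rfl fun b _ => ?_
  -- `P` is the product along the circle before the place of the relation; `z` and `y` belong to
  -- half-edges `2` and `1` of the removed vertex
  set P := (List.ofFn fun i : Fin k => ρ (C.e (b (Sum.inl i.castSucc.castSucc)))).prod with hP
  set y := C.e (b (Sum.inl (Fin.last (k + 1))))
  set z := C.e (b (Sum.inl (Fin.last k).castSucc))
  set E := C.edgeProd T.glue b
  set Q := ∏ v : Fin m, C.vertexFactor fun i => b (Sum.inr (v, i))
  have hST : stateWeight C ρ T b = E * Q * LinearMap.trace R M (P * ρ z * ρ y) := by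
    rw [stateWeight, List.ofFn_succ', List.concat_eq_append, List.prod_append,
      List.prod_singleton, List.ofFn_succ', List.concat_eq_append, List.prod_append,
      List.prod_singleton]
  have hSU : stateWeight C ρ U (b ∘ stuSwap k m) =
      E * Q * LinearMap.trace R M (P * ρ y * ρ z) := by
    rw [stateWeight, ← C.edgeProd_conj (stuSwap k m) hTU, List.ofFn_succ', List.concat_eq_append,
      List.prod_append, List.prod_singleton, List.ofFn_succ', List.concat_eq_append,
      List.prod_append, List.prod_singleton]
    have hc : ∀ i : Fin k, stuSwap k m (Sum.inl i.castSucc.castSucc) =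
        Sum.inl i.castSucc.castSucc := fun i => by
      apply HalfEdge.resolve_injective
      rw [resolve_stuSwap]
      simp [HalfEdge.resolve]
    have h1 : stuSwap k m (Sum.inl (Fin.last (k + 1))) = Sum.inl (Fin.last k).castSucc := by
      simp [stuSwap]
    have h2 : stuSwap k m (Sum.inl (Fin.last k).castSucc) = Sum.inl (Fin.last (k + 1)) := by
      simp [stuSwap]
    have h3 : ∀ p, stuSwap k m (Sum.inr p) = Sum.inr p := fun _ => rfl
    simp only [Function.comp_apply, h1, h2, hc, h3]
    rfl
  have hSS : ∀ i j, stateWeight C ρ S (stuLabelling b i j) =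
      E * Q * LinearMap.trace R M
        (P * ρ ((C.gram i j * C.form (C.e j) ⁅z, y⁆) • C.e i)) := fun i j => by
    have h1 : ∀ v : Fin m, ∀ t, stuLabelling b i j (Sum.inr (v.castSucc, t)) =
        b (Sum.inr (v, t)) := fun v t => stuLabelling_resolve b i j (Sum.inr (v, t))
    have h2 : ∀ p : Fin k, stuLabelling b i j (Sum.inl p.castSucc) =
        b (Sum.inl p.castSucc.castSucc) := fun p => by
      rw [← stuLabelling_resolve b i j]; simp [HalfEdge.resolve]
    have h3 : stuLabelling b i j (Sum.inr (Fin.last m, 1)) = b (Sum.inl (Fin.last (k + 1))) := by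
      rw [← stuLabelling_resolve b i j]; simp [HalfEdge.resolve]
    have h4 : stuLabelling b i j (Sum.inr (Fin.last m, 2)) =
        b (Sum.inl (Fin.last k).castSucc) := by
      rw [← stuLabelling_resolve b i j]; simp [HalfEdge.resolve]
    rw [stateWeight, edgeProd_stu C h0 hT, Fin.prod_univ_castSucc, List.ofFn_succ',
      List.concat_eq_append, List.prod_append, List.prod_singleton, stuLabelling_circle]
    simp only [h1, h2]
    rw [CasimirData.vertexFactor, stuLabelling_vertex, h3, h4, ← hP]
    simp only [mul_smul_comm, map_smul, smul_eq_mul]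
    ring
  simp only [hSS, hST, hSU, ← Finset.mul_sum, ← map_sum, ← mul_sub]
  rw [C.sum_gram_mul_form_smul, LieHom.map_lie, LieRing.of_associative_ring_bracket, mul_sub,
    map_sub]
  simp only [mul_assoc]

theorem ChordDiagram.chordAt_coe {d : ℕ} (D : ChordDiagram d) (a : D.Chord) :
    D.chordAt a.1 = a := by
  rw [ChordDiagram.chordAt, dif_pos a.2]

theorem ChordDiagram.chordAt_partner {d : ℕ} (D : ChordDiagram d) (p : Fin (2 * d)) :
    D.chordAt (D.partner p) = D.chordAt p := by
  unfold ChordDiagram.chordAt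
  by_cases h : p < D.partner p
  · rw [dif_pos h, dif_neg (by rw [D.partner_partner]; exact h.asymm)]
    exact Subtype.ext (D.partner_partner p)
  · have h' : D.partner p < p := lt_of_le_of_ne (not_lt.mp h) (D.partner_ne p)
    rw [dif_neg h, dif_pos (by rwa [D.partner_partner])]

/-- The chord ends are the first ends and the second ends of the chords. -/
theorem ChordDiagram.prod_ends {R : Type*} [CommMonoid R] {d : ℕ} (D : ChordDiagram d)
    (F : Fin (2 * d) → R) : ∏ p, F p = ∏ a : D.Chord, F a.1 * F (D.partner a.1) := by
  rw [Finset.prod_mul_distrib, ← Fintype.prod_subtype_mul_prod_subtype (fun p => p < D.partner p) F]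
  congr 1
  refine Finset.prod_bij' (fun x _ => ⟨D.partner x.1, ?_⟩) (fun a _ => ⟨D.partner a.1, ?_⟩)
    ?_ ?_ ?_ ?_ ?_
  · rw [D.partner_partner]
    exact lt_of_le_of_ne (not_lt.mp x.2) (D.partner_ne _)
  · rw [D.partner_partner]
    exact a.2.asymm
  all_goals simp [D.partner_partner]

theorem CasimirData.edgeProd_toTrivalent (C : CasimirData R g ι) {d : ℕ} (D : ChordDiagram d)
    (a : HalfEdge (2 * d) 0 → ι) :
    C.edgeProd D.toTrivalent.glue a =
      ∏ x : D.Chord, C.gram (a (Sum.inl x.1)) (a (Sum.inl (D.partner x.1))) := by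
  symm
  refine Finset.prod_bij
    (fun x _ => s((Sum.inl x.1 : HalfEdge (2 * d) 0), Sum.inl (D.partner x.1))) ?_ ?_ ?_ ?_
  · intro x _
    exact Finset.mem_image.mpr ⟨Sum.inl x.1, Finset.mem_univ _, rfl⟩
  · intro x _ y _ h
    have h' : x.1 = y.1 ∧ D.partner x.1 = D.partner y.1 ∨
        x.1 = D.partner y.1 ∧ D.partner x.1 = y.1 := by simpa using h
    rcases h' with h' | h'
    · exact Subtype.ext h'.1
    · have hx := x.2
      have hy := y.2
      rw [h'.2, h'.1] at hx
      exact absurd hx hy.asymm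
  · intro z hz
    obtain ⟨h, -, rfl⟩ := Finset.mem_image.mp hz
    rcases h with p | p
    · by_cases hp : p < D.partner p
      · exact ⟨⟨p, hp⟩, Finset.mem_univ _, rfl⟩
      · refine ⟨⟨D.partner p, ?_⟩, Finset.mem_univ _, ?_⟩
        · rw [D.partner_partner]
          exact lt_of_le_of_ne (not_lt.mp hp) (D.partner_ne p)
        · simp only [D.partner_partner]
          rw [Sym2.eq_swap]
          rfl
    · exact p.1.elim0
  · intro x _
    rfl

theorem trivalentWeight_toTrivalent (C : CasimirData R g ι) (ρ : g →ₗ⁅R⁆ Module.End R M) {d : ℕ}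
    (D : ChordDiagram d) : trivalentWeight C ρ D.toTrivalent = lieWeight C ρ D := by
  classical
  -- the coefficients of the two tensor factors of a summand of the Casimir element
  let A : (D.Chord → ι) → Fin (2 * d) → ι → R := fun c p j =>
    if p < D.partner p then (if c (D.chordAt p) = j then 1 else 0)
    else C.gram (c (D.chordAt p)) j
  let t : MultilinearMap R (fun _ : Fin (2 * d) => Module.End R M) R :=
    (LinearMap.trace R M).compMultilinearMap (MultilinearMap.mkPiAlgebraFin R _ _)
  have ht : ∀ f, t f = LinearMap.trace R M (List.ofFn f).prod := fun f => by simp [t]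
  have hA : ∀ c p, ρ (if p < D.partner p then C.e (c (D.chordAt p))
      else C.e' (c (D.chordAt p))) = ∑ j, A c p j • ρ (C.e j) := fun c p => by
    by_cases hp : p < D.partner p
    · simp [A, hp]
    · simp only [A, hp, if_false]
      rw [C.dual_eq_sum_gram, map_sum]
      simp
  have hsum : ∀ b : Fin (2 * d) → ι, ∑ c, ∏ p, A c p (b p) =
      ∏ x : D.Chord, C.gram (b x.1) (b (D.partner x.1)) := fun b => by
    have : ∀ c, ∏ p, A c p (b p) = ∏ x : D.Chord,
        (if c x = b x.1 then 1 else 0) * C.gram (c x) (b (D.partner x.1)) := fun c => by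
      rw [D.prod_ends]
      refine Finset.prod_congr rfl fun x _ => ?_
      simp only [A]
      rw [if_pos x.2, D.partner_partner, if_neg x.2.asymm, D.chordAt_partner, D.chordAt_coe]
    simp_rw [this]
    rw [← Fintype.prod_sum
      (fun (x : D.Chord) i => (if i = b x.1 then 1 else 0) * C.gram i (b (D.partner x.1)))]
    simp
  calc trivalentWeight C ρ D.toTrivalent
      = ∑ b : Fin (2 * d) → ι, (∏ x : D.Chord, C.gram (b x.1) (b (D.partner x.1))) *
          t fun p => ρ (C.e (b p)) := by
        refine Fintype.sum_equiv ((Equiv.sumEmpty _ _).arrowCongr (Equiv.refl ι)) _ _ fun a => ?_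
        rw [stateWeight, C.edgeProd_toTrivalent, ht]
        simp
    _ = ∑ b : Fin (2 * d) → ι, ∑ c, (∏ p, A c p (b p)) * t fun p => ρ (C.e (b p)) := by
        simp_rw [← hsum, Finset.sum_mul]
    _ = lieWeight C ρ D := by
        rw [Finset.sum_comm, lieWeight]
        refine Finset.sum_congr rfl fun c _ => ?_
        rw [← ht]
        simp_rw [hA, MultilinearMap.map_sum, MultilinearMap.map_smul_univ, smul_eq_mul]

/-- The value of the weight system of a Lie algebra on chord diagrams extends to a linear form
on `A_d`. -/
theorem exists_weightSystem_lieWeight (C : CasimirData R g ι) (ρ : g →ₗ⁅R⁆ Module.End R M)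
    (d : ℕ) : ∃ w : WeightSystem R d, ∀ D : ChordDiagram d, w (D.toA R) = lieWeight C ρ D := by
  let F : (AnyDiagram →₀ R) →ₗ[R] R :=
    Finsupp.lsum R fun D => LinearMap.toSpanSingleton R R (trivalentWeight C ρ D.2.2)
  have hF : ∀ {k m : ℕ} (D : TrivalentDiagram k m),
      F (diagramGenerator R D) = trivalentWeight C ρ D := fun D => by
    simp [F, diagramGenerator]
  have hle : Submodule.span R {x | DiagramRelation R x} ≤ LinearMap.ker F := by
    rw [Submodule.span_le]
    rintro x (⟨D, D', h⟩ | ⟨S, T, U, h⟩)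
    · simp [hF, trivalentWeight_congr C ρ h]
    · simp [hF, trivalentWeight_stu C ρ h]
  refine ⟨(Submodule.liftQ _ F hle) ∘ₗ (homogeneousPart R d).subtype, fun D => ?_⟩
  exact (hF D.toTrivalent).trans (trivalentWeight_toTrivalent C ρ D)

end StateSum

/-! ### Lie algebra weights as sums over closed paths -/

noncomputable section PathSum

theorem Matrix.prod_ofFn_apply {R J : Type*} [CommSemiring R] [Fintype J] [DecidableEq J] {m : ℕ}
    (A : Fin m → Matrix J J R) (i j : J) :
    (List.ofFn A).prod i j = ∑ x : Fin (m + 1) → J,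
      if x 0 = i ∧ x (Fin.last m) = j then ∏ p, A p (x p.castSucc) (x p.succ) else 0 := by
  induction m generalizing i with
  | zero =>
    rw [Fintype.sum_equiv (Equiv.funUnique (Fin 1) J) _
      (fun k => if k = i ∧ k = j then 1 else 0) fun x => by simp]
    simp [Matrix.one_apply, ite_and]
  | succ m ih =>
    rw [List.ofFn_succ, List.prod_cons, Matrix.mul_apply,
      ← Fintype.sum_equiv (Fin.consEquiv fun _ : Fin (m + 2) => J)
        (fun y => if y.1 = i ∧ y.2 (Fin.last m) = j then
          A 0 i (y.2 0) * ∏ p : Fin m, A p.succ (y.2 p.castSucc) (y.2 p.succ) else 0) _ ?_,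
      Fintype.sum_prod_type]
    · simp only [ite_and]
      simp only [Finset.sum_ite_irrel, Finset.sum_const_zero, Finset.sum_ite_eq', Finset.mem_univ,
        if_true]
      simp_rw [ih, Finset.mul_sum]
      rw [Finset.sum_comm]
      refine Finset.sum_congr rfl fun x _ => ?_
      simp [ite_and]
    · rintro ⟨k, y⟩
      have h0 : (Fin.consEquiv fun _ : Fin (m + 2) => J) (k, y) = Fin.cons k y := rfl
      have hl : (Fin.cons k y : Fin (m + 2) → J) (Fin.last (m + 1)) = y (Fin.last m) :=
        Fin.cons_succ (α := fun _ => J) k y (Fin.last m)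
      simp only [h0, Fin.cons_zero, hl]
      split_ifs with h
      · rw [Fin.prod_univ_succ]
        simp only [Fin.castSucc_zero, Fin.cons_zero, Fin.cons_succ, h.1, ← Fin.succ_castSucc]
      · rfl

theorem Matrix.trace_prod_ofFn {R J : Type*} [CommSemiring R] [Fintype J] [DecidableEq J] {m : ℕ}
    (A : Fin m → Matrix J J R) :
    (List.ofFn A).prod.trace = ∑ x : Fin (m + 1) → J,
      if x 0 = x (Fin.last m) then ∏ p, A p (x p.castSucc) (x p.succ) else 0 := by
  simp_rw [Matrix.trace, Matrix.diag_apply, Matrix.prod_ofFn_apply]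
  rw [Finset.sum_comm]
  refine Finset.sum_congr rfl fun x _ => ?_
  simp [ite_and, eq_comm]

variable {R g M : Type*} [Field R] [LieRing g] [LieAlgebra R g] [AddCommGroup M] [Module R M]
  {ι : Type} [Fintype ι] [DecidableEq ι]

/-- The matrix coefficients of the action of the Casimir element on `M ⊗ M`. -/
def casimirTensor {J : Type*} [Fintype J] [DecidableEq J] (b : Module.Basis J R M)
    (C : CasimirData R g ι) (ρ : g →ₗ⁅R⁆ Module.End R M) (r s t u : J) : R :=
  ∑ i, LinearMap.toMatrix b b (ρ (C.e i)) r s * LinearMap.toMatrix b b (ρ (C.e' i)) t u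

/-- The trace along the circle is a sum over closed paths of basis indices, one index for each arc
of the circle; the circle is cut open before the first chord end. -/
theorem lieWeight_eq_sum_paths {J : Type*} [Fintype J] [DecidableEq J] (b : Module.Basis J R M)
    (C : CasimirData R g ι) (ρ : g →ₗ⁅R⁆ Module.End R M) {d : ℕ} (D : ChordDiagram d) :
    lieWeight C ρ D = ∑ x : Fin (2 * d + 1) → J, if x 0 = x (Fin.last _) then
      ∏ a : D.Chord, casimirTensor b C ρ (x a.1.castSucc) (x a.1.succ)
        (x (D.partner a.1).castSucc) (x (D.partner a.1).succ) else 0 := by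
  have htr : ∀ f : Fin (2 * d) → Module.End R M, LinearMap.trace R M (List.ofFn f).prod =
      (List.ofFn fun p => LinearMap.toMatrix b b (f p)).prod.trace := fun f => by
    rw [LinearMap.trace_eq_matrix_trace R b]
    congr 1
    have h := map_list_prod (LinearMap.toMatrixAlgEquiv b) (List.ofFn f)
    rw [List.map_ofFn] at h
    exact h
  simp_rw [lieWeight, htr, Matrix.trace_prod_ofFn]
  rw [Finset.sum_comm]
  refine Finset.sum_congr rfl fun x _ => ?_
  split_ifs with hx
  · simp only [casimirTensor]
    rw [Fintype.prod_sum]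
    refine Finset.sum_congr rfl fun c _ => ?_
    rw [D.prod_ends]
    refine Finset.prod_congr rfl fun a _ => ?_
    rw [if_pos a.2, D.partner_partner, if_neg a.2.asymm, D.chordAt_partner, D.chordAt_coe]
  · simp

end PathSum

/-! ### The Casimir elements of a direct sum of matrix Lie algebras -/

noncomputable section DirectSumCasimir

variable {R g : Type*} [Field R] [LieRing g] [LieAlgebra R g] {n d : ℕ}

/-- The basis of `(R^n)^{⊗ d}` that consists of the tensor products of standard basis vectors. -/
def tensorBasis (R : Type*) [Field R] (n d : ℕ) :
    Module.Basis (Fin d → Fin n) R (⨂[R] _ : Fin d, (Fin n → R)) :=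
  Basis.piTensorProduct fun _ => Pi.basisFun R (Fin n)

theorem toMatrix_applyFactor (i : Fin d) (φ : Module.End R (Fin n → R)) (r s : Fin d → Fin n) :
    LinearMap.toMatrix (tensorBasis R n d) (tensorBasis R n d) (applyFactor i φ) r s =
      if ∀ j, j ≠ i → r j = s j then LinearMap.toMatrix' φ (r i) (s i) else 0 := by
  rw [LinearMap.toMatrix_apply, tensorBasis, Basis.piTensorProduct_apply, applyFactor,
    PiTensorProduct.map_tprod, Basis.piTensorProduct_repr_tprod_apply,
    ← Finset.mul_prod_erase _ _ (Finset.mem_univ i)]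
  have h1 : ∏ j ∈ Finset.univ.erase i, (Pi.basisFun R (Fin n)).repr
      ((Function.update (fun _ : Fin d => (LinearMap.id : (Fin n → R) →ₗ[R] (Fin n → R))) i φ) j
        (Pi.basisFun R (Fin n) (s j))) (r j) =
      ∏ j ∈ Finset.univ.erase i, if r j = s j then (1 : R) else 0 := by
    refine Finset.prod_congr rfl fun j hj => ?_
    rw [Function.update_of_ne (Finset.ne_of_mem_erase hj)]
    simp [Pi.single_apply]
  rw [h1, Finset.prod_boole, Function.update_self]
  simp [LinearMap.toMatrix'_apply]

theorem tensorPowerRep_of (τ : g →ₗ⁅R⁆ Module.End R (Fin n → R)) (i : Fin d) (x : g) :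
    tensorPowerRep τ d (DirectSum.of (fun _ => g) i x) = factorRep τ i x := by
  let f : ∀ i : Fin d, g →ₗ[R] Module.End R (⨂[R] _ : Fin d, Fin n → R) := fun i => factorRep τ i
  change DirectSum.toModule R (Fin d) _ f (DirectSum.lof R (Fin d) (fun _ => g) i x) = f i x
  rw [DirectSum.toModule_lof]

theorem tensorPowerRep_apply (τ : g →ₗ⁅R⁆ Module.End R (Fin n → R)) (z : ⨁ _ : Fin d, g) :
    tensorPowerRep τ d z = ∑ i, applyFactor i (τ (z i)) := by
  have h : (tensorPowerRep τ d : (⨁ _ : Fin d, g) →ₗ[R] Module.End R (⨂[R] _ : Fin d, Fin n → R)) =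
      ∑ i, (factorRep τ i : g →ₗ[R] Module.End R (⨂[R] _ : Fin d, Fin n → R)) ∘ₗ
        DirectSum.component R (Fin d) (fun _ => g) i := by
    refine DirectSum.linearMap_ext R fun j => LinearMap.ext fun x => ?_
    rw [LinearMap.comp_apply, LinearMap.comp_apply, LinearMap.sum_apply]
    refine (tensorPowerRep_of τ j x).trans ?_
    rw [Finset.sum_eq_single j]
    · rw [LinearMap.comp_apply, DirectSum.component.lof_self]
      rfl
    · intro i _ hij
      simp [DirectSum.component.of, hij.symm]
    · simp
  have h2 := LinearMap.congr_fun h z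
  rw [LinearMap.sum_apply] at h2
  exact h2

/-- The invariant form `B` of a Lie algebra `g` of `n × n` matrices represents the matrix entries:
the entry at `(t, u)` is the pairing with the element `F u t`, whose matrix is
`E_{u t} + ε E_{t u}`. The case `ε = 0` is that of `gl_n`, and `ε = -1` that of `so_n`. -/
structure IsEntryForm (τ : g →ₗ⁅R⁆ Module.End R (Fin n → R)) (ε : R) (B : LinearMap.BilinForm R g)
    (F : Fin n → Fin n → g) : Prop where
  symm : ∀ x y, B x y = B y x
  invariant : ∀ x y z, B ⁅x, y⁆ z = B x ⁅y, z⁆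
  injective : Function.Injective τ
  entry : ∀ y t u, LinearMap.toMatrix' (τ y) t u = B y (F u t)
  entry_F : ∀ u t r s, LinearMap.toMatrix' (τ (F u t)) r s =
    (if r = u ∧ s = t then 1 else 0) + ε * if r = t ∧ s = u then 1 else 0

/-- The form on a direct sum that is `(l i)⁻¹ • B` on the `i`-th summand. -/
def sumForm (B : LinearMap.BilinForm R g) (l : Fin d → R) :
    LinearMap.BilinForm R (⨁ _ : Fin d, g) :=
  ∑ i, (l i)⁻¹ • B.compl₁₂ (DirectSum.component R (Fin d) (fun _ => g) i)
    (DirectSum.component R (Fin d) (fun _ => g) i)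

theorem sumForm_apply (B : LinearMap.BilinForm R g) (l : Fin d → R) (x y : ⨁ _ : Fin d, g) :
    sumForm B l x y = ∑ i, (l i)⁻¹ * B (x i) (y i) := by
  simp [sumForm, LinearMap.sum_apply]
  rfl

theorem sumForm_of (B : LinearMap.BilinForm R g) (l : Fin d → R) (x : ⨁ _ : Fin d, g)
    (i : Fin d) (y : g) :
    sumForm B l x (DirectSum.of (fun _ => g) i y) = (l i)⁻¹ * B (x i) y := by
  rw [sumForm_apply, Finset.sum_eq_single i]
  · rw [DirectSum.of_eq_same]
  · intro j _ hj
    rw [DirectSum.of_eq_of_ne _ _ _ hj, map_zero, mul_zero]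
  · simp

/-- For nonzero `l i`, the direct sum has a Casimir element that is `l i` times the standard one on
the `i`-th summand. Its action on `(R^n)^{⊗ d} ⊗ (R^n)^{⊗ d}` can be read off from the duality
between `F` and the matrix entries, without an explicit basis of `g`. -/
theorem IsEntryForm.exists_casimirTensor_eq [Module.Finite R g]
    {τ : g →ₗ⁅R⁆ Module.End R (Fin n → R)} {ε : R} {B : LinearMap.BilinForm R g}
    {F : Fin n → Fin n → g} (hB : IsEntryForm τ ε B F) (l : Fin d → R) (hl : ∀ i, l i ≠ 0) :
    ∃ (k : ℕ) (C : CasimirData R (⨁ _ : Fin d, g) (Fin k)), ∀ r s t u : Fin d → Fin n,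
      casimirTensor (tensorBasis R n d) C (tensorPowerRep τ d) r s t u =
        ∑ i, if ∀ j, j ≠ i → r j = s j ∧ t j = u j then
          l i * ((if r i = u i ∧ s i = t i then 1 else 0) +
            ε * if r i = t i ∧ s i = u i then 1 else 0) else 0 := by
  have hsymm : ∀ x y, sumForm B l x y = sumForm B l y x := fun x y => by
    simp only [sumForm_apply, hB.symm]
  have hsep : ∀ x, (∀ y, sumForm B l x y = 0) → x = 0 := fun x hx => by
    refine DFinsupp.ext fun i => hB.injective ?_
    change τ (x i) = τ 0
    rw [map_zero, ← LinearMap.toMatrix'.map_eq_zero_iff]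
    ext t u
    have := hx (DirectSum.of (fun _ => g) i (F u t))
    rw [sumForm_of, ← hB.entry] at this
    exact (mul_eq_zero.mp this).resolve_left (inv_ne_zero (hl i))
  have hnd : (sumForm B l).Nondegenerate :=
    ⟨hsep, fun x hx => hsep x fun y => by rw [hsymm]; exact hx y⟩
  let b := Module.finBasis R (⨁ _ : Fin d, g)
  let C : CasimirData R (⨁ _ : Fin d, g) (Fin _) :=
    { form := sumForm B l
      symm := ⟨hsymm⟩
      invariant := fun x y z => by
        simp only [sumForm_apply, DirectSum.bracket_apply, hB.invariant]
      nondegenerate := hnd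
      e := b
      e' := (sumForm B l).dualBasis hnd b
      dual := fun i j => LinearMap.BilinForm.apply_dualBasis_left hnd b j i }
  refine ⟨_, C, fun r s t u => ?_⟩
  -- a matrix coefficient of the dual basis is a pairing with a fixed element `Z`
  let Z : ⨁ _ : Fin d, g := ∑ i, if ∀ j, j ≠ i → t j = u j then
    l i • DirectSum.of (fun _ => g) i (F (u i) (t i)) else 0
  have hZ : ∀ y, LinearMap.toMatrix (tensorBasis R n d) (tensorBasis R n d)
      (tensorPowerRep τ d y) t u = C.form y Z := fun y => by
    rw [tensorPowerRep_apply, map_sum, Matrix.sum_apply, map_sum]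
    refine Finset.sum_congr rfl fun i _ => ?_
    rw [toMatrix_applyFactor, hB.entry]
    split_ifs with h
    · rw [map_smul, smul_eq_mul]
      change _ = l i * sumForm B l y _
      rw [sumForm_of, mul_inv_cancel_left₀ (hl i)]
    · rw [map_zero]
  have hsum : casimirTensor (tensorBasis R n d) C (tensorPowerRep τ d) r s t u =
      LinearMap.toMatrix (tensorBasis R n d) (tensorBasis R n d) (tensorPowerRep τ d Z) r s := by
    conv_rhs => rw [← C.sum_form_smul Z]
    simp only [casimirTensor, hZ, map_sum, map_smul, Matrix.sum_apply, Matrix.smul_apply,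
      smul_eq_mul]
    exact Finset.sum_congr rfl fun i _ => mul_comm _ _
  rw [hsum, map_sum, map_sum, Matrix.sum_apply]
  refine Finset.sum_congr rfl fun i _ => ?_
  have hof : ∀ x : g, tensorPowerRep τ d (DirectSum.of (fun _ => g) i x) = applyFactor i (τ x) :=
    tensorPowerRep_of τ i
  by_cases htu : ∀ j, j ≠ i → t j = u j
  · rw [if_pos htu, map_smul, hof, map_smul, Matrix.smul_apply, toMatrix_applyFactor,
      hB.entry_F, smul_eq_mul, mul_ite, mul_zero]
    exact if_congr ⟨fun h j hj => ⟨h j hj, htu j hj⟩, fun h j hj => (h j hj).1⟩ rfl rfl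
  · rw [if_neg htu, if_neg fun h => htu fun j hj => (h j hj).2]
    simp

theorem glRep_toMatrix (n : ℕ) (A : Matrix (Fin n) (Fin n) R) :
    LinearMap.toMatrix' (glRep R n A) = A :=
  LinearEquiv.apply_symm_apply (LinearMap.toMatrix' (R := R) (m := Fin n) (n := Fin n)) A

/-- The form `(A, B) ↦ c * tr (A B)` on matrices. -/
def matrixTraceForm (R : Type*) [Field R] (n : ℕ) (c : R) :
    LinearMap.BilinForm R (Matrix (Fin n) (Fin n) R) :=
  c • (LinearMap.mul R (Matrix (Fin n) (Fin n) R)).compr₂ (Matrix.traceLinearMap (Fin n) R R)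

theorem matrixTraceForm_apply (n : ℕ) (c : R) (A B : Matrix (Fin n) (Fin n) R) :
    matrixTraceForm R n c A B = c * (A * B).trace := rfl

theorem matrixTraceForm_symm (n : ℕ) (c : R) (A B : Matrix (Fin n) (Fin n) R) :
    matrixTraceForm R n c A B = matrixTraceForm R n c B A := by
  rw [matrixTraceForm_apply, matrixTraceForm_apply, Matrix.trace_mul_comm]

theorem matrixTraceForm_invariant (n : ℕ) (c : R) (A B D : Matrix (Fin n) (Fin n) R) :
    matrixTraceForm R n c ⁅A, B⁆ D = matrixTraceForm R n c A ⁅B, D⁆ := by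
  simp only [matrixTraceForm_apply, Ring.lie_def, sub_mul, mul_sub, Matrix.trace_sub]
  rw [Matrix.mul_assoc, Matrix.mul_assoc, Matrix.trace_mul_comm B, Matrix.mul_assoc]

/-- The trace form represents the entries, since `tr (A E_{u t}) = A_{t u}`. -/
theorem glRep_isEntryForm (R : Type*) [Field R] (n : ℕ) :
    IsEntryForm (glRep R n) 0 (matrixTraceForm R n 1) fun u t => Matrix.single u t 1 where
  symm := matrixTraceForm_symm n 1
  invariant := matrixTraceForm_invariant n 1
  injective := (lieEquivMatrix' (R := R) (n := Fin n)).symm.injective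
  entry A t u := by
    rw [glRep_toMatrix, matrixTraceForm_apply, Matrix.trace_mul_single]
    simp
  entry_F u t r s := by
    rw [glRep_toMatrix, Matrix.single_apply]
    simp [eq_comm]

/-- The form `(A, B) ↦ tr (A B) / 2` on skew-symmetric matrices. -/
def soForm (R : Type*) [Field R] (n : ℕ) :
    LinearMap.BilinForm R (LieAlgebra.Orthogonal.so (Fin n) R) :=
  (matrixTraceForm R n (1 / 2)).compl₁₂ (LieAlgebra.Orthogonal.so (Fin n) R).subtype
    (LieAlgebra.Orthogonal.so (Fin n) R).subtype

theorem soForm_apply (n : ℕ) (A B : LieAlgebra.Orthogonal.so (Fin n) R) :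
    soForm R n A B = matrixTraceForm R n (1 / 2) A.1 B.1 := rfl

/-- The skew-symmetric matrix `E_{u t} - E_{t u}`. -/
def skewSingle (R : Type*) [Field R] {n : ℕ} (u t : Fin n) :
    LieAlgebra.Orthogonal.so (Fin n) R :=
  ⟨Matrix.single u t 1 - Matrix.single t u 1, by
    rw [LieAlgebra.Orthogonal.mem_so]; simp⟩

theorem skewSingle_val (n : ℕ) (u t : Fin n) :
    (skewSingle R u t).1 = Matrix.single u t 1 - Matrix.single t u 1 := rfl

theorem soRep_toMatrix (n : ℕ) (A : LieAlgebra.Orthogonal.so (Fin n) R) :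
    LinearMap.toMatrix' (soRep R n A) = A.1 :=
  glRep_toMatrix n A.1

/-- For skew-symmetric `A`, the trace of `A (E_{u t} - E_{t u})` is `A_{t u} - A_{u t} = 2 A_{t u}`;
hence the factor `1 / 2` in the form. -/
theorem soRep_isEntryForm (R : Type*) [Field R] [CharZero R] (n : ℕ) :
    IsEntryForm (soRep R n) (-1) (soForm R n) (skewSingle R) where
  symm _ _ := matrixTraceForm_symm n _ _ _
  invariant _ _ _ := matrixTraceForm_invariant n _ _ _ _
  injective := fun A B h => Subtype.ext <| by
    rw [← soRep_toMatrix, ← soRep_toMatrix, h]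
  entry A t u := by
    have hA : A.1 u t = -A.1 t u :=
      congrFun (congrFun ((LieAlgebra.Orthogonal.mem_so (Fin n) R A.1).mp A.2) t) u
    rw [soRep_toMatrix, soForm_apply, skewSingle_val, matrixTraceForm_apply, mul_sub,
      Matrix.trace_sub, Matrix.trace_mul_single, Matrix.trace_mul_single]
    simp only [MulOpposite.op_one, one_smul]
    rw [hA]
    ring
  entry_F u t r s := by
    rw [soRep_toMatrix, skewSingle_val, Matrix.sub_apply, Matrix.single_apply, Matrix.single_apply]
    simp only [eq_comm, sub_eq_add_neg, neg_one_mul]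

end DirectSumCasimir

/-! ### Counting index loops -/

section Loops

variable {d : ℕ}

namespace ChordDiagram

theorem card_chord (D : ChordDiagram d) : Fintype.card D.Chord = d := by
  have h := D.prod_ends fun _ => (2 : ℕ)
  rw [Finset.prod_const, Finset.prod_const, Finset.card_univ, Finset.card_univ, Fintype.card_fin,
    ← sq, ← pow_mul] at h
  exact (Nat.eq_of_mul_eq_mul_left two_pos (Nat.pow_right_injective le_rfl h)).symm

theorem chordAt_eq_iff (D : ChordDiagram d) (p : Fin (2 * d)) (a : D.Chord) :
    D.chordAt p = a ↔ p = a.1 ∨ p = D.partner a.1 := by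
  constructor
  · rintro rfl
    unfold chordAt
    split_ifs with h
    · exact Or.inl rfl
    · exact Or.inr (D.partner_partner p).symm
  · rintro (rfl | rfl)
    · exact D.chordAt_coe a
    · rw [D.chordAt_partner, D.chordAt_coe]

/-- The identifications between the index strands of a chord diagram in a state `σ`, that is, a
choice of a tensor factor and of an untwisted (`false`) or twisted (`true`) term for each chord.
The circle, cut open before its first chord end, has `2 * d + 1` arcs, and along each arc runs one
strand for each of the `d` tensor factors. At a chord end only the strand of the factor chosen for
the chord is interrupted, and it is reconnected at the other end. -/
inductive Strand (D : ChordDiagram d) (σ : D.Chord → Fin d × Bool) :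
    Fin (2 * d + 1) × Fin d → Fin (2 * d + 1) × Fin d → Prop
  | close (i : Fin d) : Strand D σ (0, i) (Fin.last _, i)
  | pass (p : Fin (2 * d)) (i : Fin d) (h : i ≠ (σ (D.chordAt p)).1) :
      Strand D σ (p.castSucc, i) (p.succ, i)
  | outer (a : D.Chord) (h : (σ a).2 = false) :
      Strand D σ (a.1.castSucc, (σ a).1) ((D.partner a.1).succ, (σ a).1)
  | inner (a : D.Chord) (h : (σ a).2 = false) :
      Strand D σ (a.1.succ, (σ a).1) ((D.partner a.1).castSucc, (σ a).1)
  | before (a : D.Chord) (h : (σ a).2 = true) :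
      Strand D σ (a.1.castSucc, (σ a).1) ((D.partner a.1).castSucc, (σ a).1)
  | after (a : D.Chord) (h : (σ a).2 = true) :
      Strand D σ (a.1.succ, (σ a).1) ((D.partner a.1).succ, (σ a).1)

/-- The number of closed loops formed by the strands of a state. -/
noncomputable def loops (D : ChordDiagram d) (σ : D.Chord → Fin d × Bool) : ℕ :=
  Nat.card (Quot (D.Strand σ))

/-- Labellings of the strands that are constant along the loops. -/
abbrev LoopLabelling (D : ChordDiagram d) (σ : D.Chord → Fin d × Bool) (α : Type*) : Type _ :=
  {y : Fin (2 * d + 1) × Fin d → α // ∀ P Q, D.Strand σ P Q → y P = y Q}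

theorem card_loopLabelling (D : ChordDiagram d) (σ : D.Chord → Fin d × Bool) (α : Type*)
    [Finite α] : Nat.card (D.LoopLabelling σ α) = Nat.card α ^ D.loops σ := by
  let e : D.LoopLabelling σ α ≃ (Quot (D.Strand σ) → α) :=
    { toFun := fun y => Quot.lift y.1 y.2
      invFun := fun f => ⟨fun P => f (Quot.mk _ P), fun P Q h => congrArg f (Quot.sound h)⟩
      left_inv := fun y => rfl
      right_inv := fun f => by
        funext q
        induction q using Quot.ind
        rfl }
  rw [Nat.card_congr e, Nat.card_fun, loops]

/-- The labels at the base point and, for each chord, the jump of the label of its tensor factor at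
its first end. -/
def jumpData (D : ChordDiagram d) (σ : D.Chord → Fin d × Bool) (y : D.LoopLabelling σ (ZMod 2)) :
    (Fin d → ZMod 2) × (D.Chord → ZMod 2) :=
  (fun i => y.1 (0, i), fun a => y.1 (a.1.succ, (σ a).1) - y.1 (a.1.castSucc, (σ a).1))

/-- The jumps at the two ends of a chord agree up to sign, and signs do not matter modulo `2`. -/
theorem loopLabelling_succ (D : ChordDiagram d) (σ : D.Chord → Fin d × Bool)
    (y : D.LoopLabelling σ (ZMod 2)) (p : Fin (2 * d)) (i : Fin d) :
    y.1 (p.succ, i) = y.1 (p.castSucc, i) +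
      if i = (σ (D.chordAt p)).1 then (D.jumpData σ y).2 (D.chordAt p) else 0 := by
  by_cases hi : i = (σ (D.chordAt p)).1
  · rw [if_pos hi]
    subst hi
    rcases (D.chordAt_eq_iff p (D.chordAt p)).mp rfl with h | h
    · conv_lhs => rw [h]
      conv_rhs => rw [h]
      rw [D.chordAt_coe]
      simp [jumpData]
    · -- at the second end, the labels are those at the first end, possibly in reverse order
      generalize ha : D.chordAt p = a at h ⊢
      subst h
      simp only [jumpData]
      cases hs : (σ a).2
      · rw [← y.2 _ _ (Strand.outer a hs), ← y.2 _ _ (Strand.inner a hs)]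
        generalize y.1 _ = u
        generalize y.1 _ = v
        revert u v
        decide
      · rw [← y.2 _ _ (Strand.before a hs), ← y.2 _ _ (Strand.after a hs)]
        exact (add_sub_cancel _ _).symm
  · rw [if_neg hi, add_zero]
    exact (y.2 _ _ (Strand.pass p i hi)).symm

theorem jumpData_injective (D : ChordDiagram d) (σ : D.Chord → Fin d × Bool) :
    Function.Injective (D.jumpData σ) := by
  intro y z h
  refine Subtype.ext (funext fun ⟨p, i⟩ => ?_)
  induction p using Fin.induction with
  | zero => exact congrFun (congrArg Prod.fst h) i
  | succ p ih => rw [D.loopLabelling_succ, D.loopLabelling_succ, ih, h]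

theorem card_jumpData (D : ChordDiagram d) :
    Nat.card ((Fin d → ZMod 2) × (D.Chord → ZMod 2)) = 2 ^ (2 * d) := by
  rw [Nat.card_prod, Nat.card_fun, Nat.card_fun, Nat.card_zmod, Nat.card_eq_fintype_card,
    Nat.card_eq_fintype_card, D.card_chord, Fintype.card_fin, ← pow_add, two_mul]

theorem loops_le (D : ChordDiagram d) (σ : D.Chord → Fin d × Bool) : D.loops σ ≤ 2 * d := by
  have h := Nat.card_le_card_of_injective _ (D.jumpData_injective σ)
  rw [D.card_jumpData, D.card_loopLabelling, Nat.card_zmod] at h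
  exact (Nat.pow_le_pow_iff_right one_lt_two).mp h

theorem loops_eq_iff_surjective (D : ChordDiagram d) (σ : D.Chord → Fin d × Bool) :
    D.loops σ = 2 * d ↔ Function.Surjective (D.jumpData σ) := by
  constructor
  · intro h
    refine ((Nat.bijective_iff_injective_and_card _).mpr ⟨D.jumpData_injective σ, ?_⟩).2
    rw [D.card_jumpData, D.card_loopLabelling, Nat.card_zmod, h]
  · intro h
    have h' := Nat.card_congr (Equiv.ofBijective _ ⟨D.jumpData_injective σ, h⟩)
    rw [D.card_jumpData, D.card_loopLabelling, Nat.card_zmod] at h'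
    exact Nat.pow_right_injective le_rfl h'

/-- If only the chord `a` has a jump, the label is `1` exactly on the arcs between its ends. -/
theorem loopLabelling_single (D : ChordDiagram d) (σ : D.Chord → Fin d × Bool) (a : D.Chord)
    (y : D.LoopLabelling σ (ZMod 2)) (hy : D.jumpData σ y = (0, Pi.single a 1))
    (p : Fin (2 * d + 1)) (i : Fin d) :
    y.1 (p, i) = if i = (σ a).1 ∧ a.1.1 < p.1 ∧ p.1 ≤ (D.partner a.1).1 then 1 else 0 := by
  induction p using Fin.induction with
  | zero =>
    have h0 : y.1 (0, i) = 0 := congrFun (congrArg Prod.fst hy) i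
    simpa using h0
  | succ p ih =>
    rw [D.loopLabelling_succ, ih, hy]
    simp only [Pi.single_apply, Fin.val_castSucc, Fin.val_succ]
    have ha : a.1.1 < (D.partner a.1).1 := a.2
    by_cases hp : D.chordAt p = a
    · rw [hp]
      by_cases hi : i = (σ a).1
      · simp only [hi, true_and, if_true]
        rcases (D.chordAt_eq_iff p a).mp hp with h | h
        · subst h
          rw [if_neg (by omega), if_pos (by omega), zero_add]
        · subst h
          rw [if_pos (by omega), if_neg (by omega)]
          decide
      · simp [hi]
    · rw [if_neg hp, ite_self, add_zero]
      rw [D.chordAt_eq_iff] at hp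
      have h1 : p.1 ≠ a.1.1 := fun h => hp (Or.inl (Fin.ext h))
      have h2 : p.1 ≠ (D.partner a.1).1 := fun h => hp (Or.inr (Fin.ext h))
      exact if_congr (by omega) rfl rfl

/-- A colouring of the chords is proper if crossing chords have different colours. -/
def IsProper (D : ChordDiagram d) (c : D.Chord → Fin d) : Prop :=
  ∀ a b, D.Intersect a b → c a ≠ c b

/-- The maximal number of loops is attained if and only if no chord is twisted and
crossing chords act on different tensor factors. -/
theorem loops_eq_iff (D : ChordDiagram d) (σ : D.Chord → Fin d × Bool) :
    D.loops σ = 2 * d ↔ (∀ a, (σ a).2 = false) ∧ D.IsProper fun a => (σ a).1 := by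
  classical
  rw [loops_eq_iff_surjective]
  constructor
  · intro hsurj
    have hfalse : ∀ a, (σ a).2 = false := fun a => by
      -- a twisted chord cannot have the only jump
      obtain ⟨y, hy⟩ := hsurj (0, Pi.single a 1)
      have ha : a.1.1 < (D.partner a.1).1 := a.2
      by_contra hs
      have h := y.2 _ _ (Strand.before a (by simpa using hs))
      rw [D.loopLabelling_single σ a y hy, D.loopLabelling_single σ a y hy] at h
      simp [ha] at h
    have key : ∀ a b : D.Chord, a.1 < b.1 → b.1 < D.partner a.1 →
        D.partner a.1 < D.partner b.1 → (σ a).1 ≠ (σ b).1 := fun a b h1 h2 h3 hab => by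
      -- if only `a` has a jump, the labels outside of `b` at its two ends differ
      obtain ⟨y, hy⟩ := hsurj (0, Pi.single a 1)
      have h := y.2 _ _ (Strand.outer b (hfalse b))
      rw [D.loopLabelling_single σ a y hy, D.loopLabelling_single σ a y hy] at h
      rw [Fin.lt_def] at h1 h2 h3
      simp only [Fin.val_castSucc, Fin.val_succ] at h
      rw [if_pos ⟨hab.symm, h1, h2.le⟩, if_neg (by omega)] at h
      exact one_ne_zero h
    refine ⟨hfalse, ?_⟩
    rintro a b (⟨h1, h2, h3⟩ | ⟨h1, h2, h3⟩)
    · exact key a b h1 h2 h3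
    · exact (key b a h1 h2 h3).symm
  · rintro ⟨hfalse, hproper⟩ ⟨f, t⟩
    -- each chord with a jump adds `1` on the arcs between its ends
    let y : Fin (2 * d + 1) × Fin d → ZMod 2 := fun P => f P.2 + ∑ a : D.Chord,
      if P.2 = (σ a).1 ∧ a.1.1 < P.1.1 ∧ P.1.1 ≤ (D.partner a.1).1 then t a else 0
    have hstep : ∀ P Q : Fin (2 * d + 1) × Fin d, P.2 = Q.2 →
        (∀ a : D.Chord, P.2 = (σ a).1 →
          (a.1.1 < P.1.1 ∧ P.1.1 ≤ (D.partner a.1).1 ↔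
            a.1.1 < Q.1.1 ∧ Q.1.1 ≤ (D.partner a.1).1)) → y P = y Q := fun P Q h hPQ => by
      simp only [y, h]
      congr 1
      refine Finset.sum_congr rfl fun a _ => if_congr ?_ rfl rfl
      rw [← h]
      exact and_congr_right fun ha => hPQ a ha
    -- the ends of two different chords of the same colour are distinct and do not alternate
    have hends : ∀ a b : D.Chord, (σ a).1 = (σ b).1 → a ≠ b →
        a.1.1 ≠ b.1.1 ∧ a.1.1 ≠ (D.partner b.1).1 ∧ (D.partner a.1).1 ≠ b.1.1 ∧
        (D.partner a.1).1 ≠ (D.partner b.1).1 ∧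
        ¬ ((a.1.1 < b.1.1 ∧ b.1.1 < (D.partner a.1).1 ∧
            (D.partner a.1).1 < (D.partner b.1).1) ∨
          (b.1.1 < a.1.1 ∧ a.1.1 < (D.partner b.1).1 ∧
            (D.partner b.1).1 < (D.partner a.1).1)) := fun a b hab hne => by
      have hb : ∀ p, D.chordAt p = a → D.chordAt p ≠ b := fun p h h' => hne (h ▸ h')
      have e1 := D.chordAt_coe a
      have e2 : D.chordAt (D.partner a.1) = a := by rw [D.chordAt_partner, e1]
      have h1 := hb _ e1
      have h2 := hb _ e2
      rw [Ne, D.chordAt_eq_iff, not_or] at h1 h2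
      exact ⟨fun h => h1.1 (Fin.ext h), fun h => h1.2 (Fin.ext h), fun h => h2.1 (Fin.ext h),
        fun h => h2.2 (Fin.ext h), fun h => hproper a b h hab⟩
    have hy : ∀ P Q, D.Strand σ P Q → y P = y Q := by
      intro P Q hPQ
      cases hPQ with
      | close i =>
        refine hstep _ _ rfl fun a _ => ?_
        have := (D.partner a.1).2
        simp only [Fin.val_zero, Fin.val_last]
        omega
      | pass p i h =>
        refine hstep _ _ rfl fun a ha => ?_
        have hp : D.chordAt p ≠ a := fun h' => h (by rw [h']; exact ha)
        rw [Ne, D.chordAt_eq_iff, not_or] at hp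
        have h1 : p.1 ≠ a.1.1 := fun h => hp.1 (Fin.ext h)
        have h2 : p.1 ≠ (D.partner a.1).1 := fun h => hp.2 (Fin.ext h)
        simp only [Fin.val_castSucc, Fin.val_succ]
        omega
      | outer b h =>
        refine hstep _ _ rfl fun a ha => ?_
        have hb : b.1.1 < (D.partner b.1).1 := b.2
        have ha' : a.1.1 < (D.partner a.1).1 := a.2
        simp only [Fin.val_castSucc, Fin.val_succ]
        by_cases hab : a = b
        · subst hab; omega
        · have := hends a b ha.symm hab
          omega
      | inner b h =>
        refine hstep _ _ rfl fun a ha => ?_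
        have hb : b.1.1 < (D.partner b.1).1 := b.2
        have ha' : a.1.1 < (D.partner a.1).1 := a.2
        simp only [Fin.val_castSucc, Fin.val_succ]
        by_cases hab : a = b
        · subst hab; omega
        · have := hends a b ha.symm hab
          omega
      | before b h => rw [hfalse b] at h; exact absurd h (by decide)
      | after b h => rw [hfalse b] at h; exact absurd h (by decide)
    refine ⟨⟨y, hy⟩, Prod.ext (funext fun i => by simp [jumpData, y]) (funext fun a => ?_)⟩
    simp only [jumpData, y, Fin.val_castSucc, Fin.val_succ]
    rw [add_sub_add_left_eq_sub, ← Finset.sum_sub_distrib, Finset.sum_eq_single a]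
    · have ha : a.1.1 < (D.partner a.1).1 := a.2
      rw [if_pos ⟨rfl, by omega⟩, if_neg (by omega), sub_zero]
    · intro b _ hba
      by_cases hc : (σ a).1 = (σ b).1
      · have := hends a b hc hba.symm
        rw [sub_eq_zero]
        exact if_congr (by omega) rfl rfl
      · simp [hc]
    · simp

end ChordDiagram

/-- The Lie algebra weight of a chord diagram is a sum over the states, in which each loop
contributes a factor `n`. -/
theorem lieWeight_eq_sum_states {R g : Type*} [Field R] [LieRing g] [LieAlgebra R g] {n : ℕ}
    {ι : Type} [Fintype ι] [DecidableEq ι] {C : CasimirData R (⨁ _ : Fin d, g) ι}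
    {τ : g →ₗ⁅R⁆ Module.End R (Fin n → R)} {ε : R} {l : Fin d → R}
    (hC : ∀ r s t u : Fin d → Fin n,
      casimirTensor (tensorBasis R n d) C (tensorPowerRep τ d) r s t u =
        ∑ i, if ∀ j, j ≠ i → r j = s j ∧ t j = u j then
          l i * ((if r i = u i ∧ s i = t i then 1 else 0) +
            ε * if r i = t i ∧ s i = u i then 1 else 0) else 0)
    (D : ChordDiagram d) :
    lieWeight C (tensorPowerRep τ d) D = ∑ σ : D.Chord → Fin d × Bool,
      (∏ a, l (σ a).1 * if (σ a).2 then ε else 1) * (n : R) ^ D.loops σ := by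
  classical
  -- the term of the Casimir tensor for a factor and a choice of an untwisted or twisted term
  let K : (Fin d → Fin n) → (Fin d → Fin n) → (Fin d → Fin n) → (Fin d → Fin n) →
      Fin d × Bool → Prop := fun r s t u i =>
    (∀ j, j ≠ i.1 → r j = s j ∧ t j = u j) ∧
      (i.2 = false → r i.1 = u i.1 ∧ s i.1 = t i.1) ∧
      (i.2 = true → r i.1 = t i.1 ∧ s i.1 = u i.1)
  have hK : ∀ r s t u, casimirTensor (tensorBasis R n d) C (tensorPowerRep τ d) r s t u =
      ∑ i : Fin d × Bool, (l i.1 * if i.2 then ε else 1) * if K r s t u i then 1 else 0 :=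
    fun r s t u => by
      rw [hC, Fintype.sum_prod_type]
      refine Finset.sum_congr rfl fun i _ => ?_
      rw [Fintype.sum_bool]
      by_cases h : ∀ j, j ≠ i → r j = s j ∧ t j = u j
      · have h1 : K r s t u (i, true) ↔ r i = t i ∧ s i = u i :=
          ⟨fun k => k.2.2 rfl, fun k => ⟨h, fun h => absurd h (by simp), fun _ => k⟩⟩
        have h2 : K r s t u (i, false) ↔ r i = u i ∧ s i = t i :=
          ⟨fun k => k.2.1 rfl, fun k => ⟨h, fun _ => k, fun h => absurd h (by simp)⟩⟩
        rw [if_pos h]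
        simp only [h1, h2, if_true, Bool.false_eq_true, if_false]
        ring
      · have h1 : ∀ b, ¬ K r s t u (i, b) := fun b k => h k.1
        simp only [if_neg h, h1, if_false, mul_zero, add_zero]
  have hcomp : ∀ (σ : D.Chord → Fin d × Bool) (x : Fin (2 * d + 1) → Fin d → Fin n),
      (x 0 = x (Fin.last _) ∧ ∀ a : D.Chord, K (x a.1.castSucc) (x a.1.succ)
        (x (D.partner a.1).castSucc) (x (D.partner a.1).succ) (σ a)) ↔
      ∀ P Q, D.Strand σ P Q → x P.1 P.2 = x Q.1 Q.2 := fun σ x => by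
    constructor
    · rintro ⟨h0, h⟩ P Q hPQ
      cases hPQ with
      | close i => exact congrFun h0 i
      | pass p i hi =>
        have ha := (h (D.chordAt p)).1 i hi
        rcases (D.chordAt_eq_iff p (D.chordAt p)).mp rfl with hp | hp
        · rw [← hp] at ha; exact ha.1
        · rw [← hp] at ha; exact ha.2
      | outer a hs => exact ((h a).2.1 hs).1
      | inner a hs => exact ((h a).2.1 hs).2
      | before a hs => exact ((h a).2.2 hs).1
      | after a hs => exact ((h a).2.2 hs).2
    · intro h
      refine ⟨funext fun i => h _ _ (.close i), fun a => ⟨fun j hj => ⟨?_, ?_⟩,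
        fun hs => ⟨h _ _ (.outer a hs), h _ _ (.inner a hs)⟩,
        fun hs => ⟨h _ _ (.before a hs), h _ _ (.after a hs)⟩⟩⟩
      · exact h _ _ (.pass a.1 j (by rwa [D.chordAt_coe]))
      · exact h _ _ (.pass (D.partner a.1) j (by rwa [D.chordAt_partner, D.chordAt_coe]))
  have hcount : ∀ σ : D.Chord → Fin d × Bool,
      (∑ x : Fin (2 * d + 1) → Fin d → Fin n,
        if ∀ P Q, D.Strand σ P Q → x P.1 P.2 = x Q.1 Q.2 then (1 : R) else 0) =
      (n : R) ^ D.loops σ := fun σ => by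
    have h := D.card_loopLabelling σ (Fin n)
    rw [Nat.card_fin] at h
    rw [← Nat.cast_pow, ← h, Finset.sum_boole, ← Fintype.card_subtype, ← Nat.card_eq_fintype_card]
    congr 1
    exact Nat.card_congr ((Equiv.curry _ _ _).symm.subtypeEquiv fun x => Iff.rfl)
  rw [lieWeight_eq_sum_paths (tensorBasis R n d)]
  simp_rw [hK, ← hcount, Finset.mul_sum]
  rw [Finset.sum_comm]
  refine Finset.sum_congr rfl fun x _ => ?_
  simp_rw [← hcomp]
  split_ifs with h0
  · rw [Fintype.prod_sum]
    refine Finset.sum_congr rfl fun σ _ => ?_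
    rw [Finset.prod_mul_distrib]
    congr 1
    rw [Finset.prod_boole]
    split_ifs with h1 h2 h2
    · rfl
    · exact absurd ⟨h0, fun a => h1 a (Finset.mem_univ a)⟩ h2
    · exact absurd (fun a _ => h2.2 a) h1
    · rfl
  · symm
    refine Finset.sum_eq_zero fun σ _ => ?_
    rw [if_neg fun h => h0 h.1, mul_zero]

end Loops

/-! ### The weighted chromatic function -/

noncomputable section Chromatic

attribute [local instance] WeightedGraph.fintype

namespace WeightedGraph

variable {R : Type*} [Field R] {κ : Type*} [Fintype κ]

open Classical in
/-- The weighted chromatic function of a graph: the sum over all proper colourings `c` of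
the product of the `l (c v) ^ weight v` over all vertices `v`. -/
def chromaticValue (l : κ → R) (G : WeightedGraph) : R :=
  ∑ c : G.V → κ, if ∀ x y, G.graph.Adj x y → c x ≠ c y then
    ∏ v, l (c v) ^ (G.weight v : ℕ) else 0

theorem chromaticValue_congr (l : κ → R) {G H : WeightedGraph} (h : G.Isomorphic H) :
    chromaticValue l G = chromaticValue l H := by
  classical
  obtain ⟨e, he⟩ := h
  symm
  refine Fintype.sum_equiv (e.toEquiv.symm.arrowCongr (Equiv.refl κ)) _ _ fun c => ?_
  have hc : (e.toEquiv.symm.arrowCongr (Equiv.refl κ)) c = c ∘ e := rfl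
  rw [hc]
  refine if_congr ⟨fun h x y hxy => h _ _ (e.map_rel_iff.mpr hxy), fun h x y hxy => ?_⟩ ?_ rfl
  · simpa using h (e.symm x) (e.symm y) (e.symm.map_rel_iff.mpr hxy)
  · rw [← Equiv.prod_comp e.toEquiv]
    exact Finset.prod_congr rfl fun v _ => by rw [← he v]; rfl

theorem deleteEdge_proper_iff {κ : Type*} (G : WeightedGraph) {u v : G.V}
    (h : G.graph.Adj u v) (c : G.V → κ) :
    ((∀ x y, (G.graph.deleteEdges {s(u, v)}).Adj x y → c x ≠ c y) ∧ c u ≠ c v) ↔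
      ∀ x y, G.graph.Adj x y → c x ≠ c y := by
  constructor
  · rintro ⟨h1, h2⟩ x y hxy
    by_cases he : s(x, y) = s(u, v)
    · rcases Sym2.eq_iff.mp he with ⟨rfl, rfl⟩ | ⟨rfl, rfl⟩
      · exact h2
      · exact h2.symm
    · exact h1 x y (SimpleGraph.deleteEdges_adj.mpr ⟨hxy, he⟩)
  · exact fun h1 => ⟨fun x y hxy => h1 x y (SimpleGraph.deleteEdges_adj.mp hxy).1, h1 u v h⟩

/-- The underlying graph of the contraction, with its vertices as a subtype. -/
def contractGraph (G : WeightedGraph) (u v : G.V) : SimpleGraph {x : G.V // x ≠ v} :=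
  (G.contractEdge u v).graph

theorem contractGraph_adj (G : WeightedGraph) (u v : G.V) (x y : {x : G.V // x ≠ v}) :
    (G.contractGraph u v).Adj x y ↔ x ≠ y ∧
      ((G.graph.Adj x.1 y.1 ∨ (x.1 = u ∧ G.graph.Adj v y.1)) ∨
        (G.graph.Adj y.1 x.1 ∨ (y.1 = u ∧ G.graph.Adj v x.1))) :=
  SimpleGraph.fromRel_adj _ x y

theorem contractGraph_proper_iff {κ : Type*} (G : WeightedGraph) {u v : G.V}
    (h : G.graph.Adj u v) (c : G.V → κ) (hc : c u = c v) :
    (∀ x y, (G.graph.deleteEdges {s(u, v)}).Adj x y → c x ≠ c y) ↔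
      ∀ x y : {x : G.V // x ≠ v}, (G.contractGraph u v).Adj x y → c x.1 ≠ c y.1 := by
  constructor
  · intro h1
    have key : ∀ x y : {x : G.V // x ≠ v}, x ≠ y →
        (G.graph.Adj x.1 y.1 ∨ (x.1 = u ∧ G.graph.Adj v y.1)) → c x.1 ≠ c y.1 := by
      rintro x y hne (hxy | ⟨hx, hy⟩)
      · refine h1 _ _ (SimpleGraph.deleteEdges_adj.mpr ⟨hxy, fun he => ?_⟩)
        rcases Sym2.eq_iff.mp he with ⟨-, h⟩ | ⟨h, -⟩
        · exact y.2 h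
        · exact x.2 h
      · rw [hx, hc]
        refine h1 _ _ (SimpleGraph.deleteEdges_adj.mpr ⟨hy, fun he => ?_⟩)
        rcases Sym2.eq_iff.mp he with ⟨-, h⟩ | ⟨-, h⟩
        · exact y.2 h
        · exact hne (Subtype.ext (hx.trans h.symm))
    intro x y hxy
    obtain ⟨hne, hxy | hxy⟩ := (G.contractGraph_adj u v x y).mp hxy
    · exact key x y hne hxy
    · exact (key y x hne.symm hxy).symm
  · intro h1
    have key : ∀ y, G.graph.Adj v y → s(v, y) ≠ s(u, v) → c v ≠ c y := fun y hy he => by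
      have hyv : y ≠ v := hy.ne'
      have hyu : y ≠ u := fun h => he (by rw [h, Sym2.eq_swap])
      rw [← hc]
      exact h1 ⟨u, h.ne⟩ ⟨y, hyv⟩ ((G.contractGraph_adj u v _ _).mpr
        ⟨fun h => hyu (congrArg Subtype.val h).symm, Or.inl (Or.inr ⟨rfl, hy⟩)⟩)
    intro x y hxy
    obtain ⟨hxy, he⟩ := SimpleGraph.deleteEdges_adj.mp hxy
    by_cases hx : x = v
    · rw [hx] at hxy he ⊢
      exact key y hxy he
    · by_cases hy : y = v
      · rw [hy] at hxy he ⊢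
        exact (key x hxy.symm (by rw [Sym2.eq_swap]; exact he)).symm
      · exact h1 ⟨x, hx⟩ ⟨y, hy⟩ ((G.contractGraph_adj u v _ _).mpr
          ⟨fun h => hxy.ne (congrArg Subtype.val h), Or.inl (Or.inl hxy)⟩)

open Classical in
/-- Colourings with equal colours at two vertices are colourings of the remaining vertices
after the two vertices have been merged. -/
def mergeColouring {V : Type*} {u v : V} (h : u ≠ v) (κ : Type*) :
    {c : V → κ // c u = c v} ≃ ({x : V // x ≠ v} → κ) where
  toFun c x := c.1 x.1
  invFun c := ⟨fun x => if hx : x = v then c ⟨u, h⟩ else c ⟨x, hx⟩, by simp [h]⟩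
  left_inv c := by
    refine Subtype.ext (funext fun x => ?_)
    by_cases hx : x = v
    · subst hx; simpa using c.2
    · simp [hx]
  right_inv c := by
    funext x
    exact dif_neg x.2

theorem prod_contractEdge {S : Type*} [CommMonoid S] (G : WeightedGraph) {u v : G.V}
    (h : G.graph.Adj u v) (F : G.V → S) (huv : F u = F v) :
    ∏ x : (G.contractEdge u v).V, F x.1 ^ ((G.contractEdge u v).weight x : ℕ) =
      ∏ x, F x ^ (G.weight x : ℕ) := by
  classical
  have h1 : ∀ x : {x : G.V // x ≠ v},
      F x.1 ^ ((if x.1 = u then G.weight u + G.weight v else G.weight x.1 : ℕ+) : ℕ) =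
      F x.1 ^ (G.weight x.1 : ℕ) * if x = ⟨u, h.ne⟩ then F v ^ (G.weight v : ℕ) else 1 :=
      fun x => by
    by_cases hx : x.1 = u
    · have hx' : x = ⟨u, h.ne⟩ := Subtype.ext hx
      subst hx'
      rw [if_pos rfl, if_pos rfl, PNat.add_coe, pow_add, huv]
    · rw [if_neg hx, if_neg fun h => hx (congrArg Subtype.val h), mul_one]
  have h2 : ∏ x : (G.contractEdge u v).V, F x.1 ^ ((G.contractEdge u v).weight x : ℕ) =
      ∏ x : {x : G.V // x ≠ v}, (F x.1 ^ (G.weight x.1 : ℕ) *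
        if x = ⟨u, h.ne⟩ then F v ^ (G.weight v : ℕ) else 1) :=
    Fintype.prod_equiv (Equiv.refl _) _ _ h1
  rw [h2, Finset.prod_mul_distrib, Finset.prod_ite_eq', if_pos (Finset.mem_univ _),
    ← Fintype.prod_subtype_mul_prod_subtype (fun x => x ≠ v)]
  congr 1
  have : Unique {x // ¬ x ≠ v} := ⟨⟨⟨v, by simp⟩⟩, fun x => Subtype.ext (not_not.mp x.2)⟩
  rw [Fintype.prod_unique, not_not.mp (default : {x // ¬ x ≠ v}).2]

/-- The chromatic relation for the weighted chromatic function. -/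
theorem chromaticValue_eq_sub (l : κ → R) (G : WeightedGraph) {u v : G.V}
    (h : G.graph.Adj u v) :
    chromaticValue l G =
      chromaticValue l (G.deleteEdge u v) - chromaticValue l (G.contractEdge u v) := by
  classical
  have h1 : chromaticValue l (G.deleteEdge u v) = ∑ c : G.V → κ,
      if ∀ x y, (G.graph.deleteEdges {s(u, v)}).Adj x y → c x ≠ c y then
        ∏ x, l (c x) ^ (G.weight x : ℕ) else 0 :=
    Fintype.sum_equiv (Equiv.refl _) _ _ fun c => if_congr Iff.rfl rfl rfl
  have h2 : chromaticValue l (G.contractEdge u v) = ∑ c : {c : G.V → κ // c u = c v},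
      if ∀ x y, (G.graph.deleteEdges {s(u, v)}).Adj x y → c.1 x ≠ c.1 y then
        ∏ x, l (c.1 x) ^ (G.weight x : ℕ) else 0 := by
    let e : {c : G.V → κ // c u = c v} ≃ ((G.contractEdge u v).V → κ) := mergeColouring h.ne κ
    unfold chromaticValue
    symm
    refine Fintype.sum_equiv e _ _ fun c => ?_
    refine if_congr (G.contractGraph_proper_iff h c.1 c.2) ?_ rfl
    exact (G.prod_contractEdge h (fun x => l (c.1 x)) (congrArg l c.2)).symm
  rw [eq_sub_iff_add_eq, h1, h2, chromaticValue,
    ← Fintype.sum_subtype_add_sum_subtype (fun c : G.V → κ => c u = c v)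
      (fun c => if ∀ x y, (G.graph.deleteEdges {s(u, v)}).Adj x y → c x ≠ c y then
        ∏ x, l (c x) ^ (G.weight x : ℕ) else 0),
    ← Fintype.sum_subtype_add_sum_subtype (fun c : G.V → κ => c u = c v), add_comm]
  congr 1
  rw [Finset.sum_eq_zero, zero_add]
  · refine Finset.sum_congr rfl fun c _ => if_congr ?_ rfl rfl
    rw [← G.deleteEdge_proper_iff h, and_iff_left c.2]
  · exact fun c _ => if_neg fun hc => hc u v h c.2

/-- The weighted chromatic function as a linear form on the space of graphs. -/
def chromaticForm (l : κ → R) : ChromaticSpace R →ₗ[R] R :=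
  Submodule.liftQ _ (Finsupp.linearCombination R (chromaticValue l)) <| by
    have hF : ∀ G, Finsupp.linearCombination R (chromaticValue l) (graphGenerator R G) =
        chromaticValue l G := fun G => by simp [graphGenerator]
    rw [Submodule.span_le]
    rintro x (⟨G, H, h⟩ | ⟨G, u, v, h⟩)
    · simp [hF, chromaticValue_congr l h]
    · simp [hF, chromaticValue_eq_sub l G h]

theorem chromaticForm_toC (l : κ → R) (G : WeightedGraph) :
    chromaticForm l (G.toC R) = chromaticValue l G := by
  change Finsupp.linearCombination R (chromaticValue l) (graphGenerator R G) = _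
  simp [graphGenerator]

theorem chromaticValue_of_eq_bot (l : κ → R) (G : WeightedGraph) (hG : G.graph = ⊥) :
    chromaticValue l G = ∏ v, ∑ i, l i ^ (G.weight v : ℕ) := by
  classical
  rw [Fintype.prod_sum]
  refine Fintype.sum_equiv (Equiv.refl _) _ _ fun c => if_pos ?_
  simp [hG]

/-- The sum of the weights of all vertices. -/
def totalWeight (G : WeightedGraph) : ℕ := ∑ v, (G.weight v : ℕ)

theorem totalWeight_contractEdge (G : WeightedGraph) {u v : G.V} (h : G.graph.Adj u v) :
    (G.contractEdge u v).totalWeight = G.totalWeight := by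
  have := G.prod_contractEdge h (fun _ => Multiplicative.ofAdd 1) rfl
  simpa [← ofAdd_nsmul, ← ofAdd_sum, totalWeight] using this

/-- By deletion and contraction, the graphs without edges generate the space of graphs. -/
theorem map_eq_of_forall_bot {d : ℕ} (f f' : ChromaticSpace R →ₗ[R] R)
    (h : ∀ G : WeightedGraph, G.graph = ⊥ → G.totalWeight = d → f (G.toC R) = f' (G.toC R))
    (G : WeightedGraph) (hG : G.totalWeight = d) : f (G.toC R) = f' (G.toC R) := by
  induction hN : Fintype.card G.V using Nat.strong_induction_on generalizing G with
  | _ N ihN =>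
  induction hE : G.graph.edgeSet.ncard using Nat.strong_induction_on generalizing G with
  | _ E ihE =>
  by_cases hbot : G.graph = ⊥
  · exact h G hbot hG
  · obtain ⟨u, v, huv⟩ := SimpleGraph.ne_bot_iff_exists_adj.mp hbot
    have hrel : G.toC R = (G.deleteEdge u v).toC R - (G.contractEdge u v).toC R := by
      rw [← sub_eq_zero]
      exact (Submodule.Quotient.mk_eq_zero _).mpr
        (Submodule.subset_span (ChromaticRelation.chromatic G u v huv))
    have h1 : f ((G.deleteEdge u v).toC R) = f' ((G.deleteEdge u v).toC R) := by
      refine ihE _ ?_ (G.deleteEdge u v) hG hN rfl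
      rw [← hE]
      refine Set.ncard_lt_ncard ?_ (Set.toFinite _)
      refine SimpleGraph.edgeSet_ssubset_edgeSet.mpr (lt_of_le_of_ne ?_ ?_)
      · exact SimpleGraph.deleteEdges_le _
      · intro he
        have : (G.deleteEdge u v).graph.Adj u v := he ▸ huv
        exact (SimpleGraph.deleteEdges_adj.mp this).2 rfl
    have h2 : f ((G.contractEdge u v).toC R) = f' ((G.contractEdge u v).toC R) := by
      refine ihN _ ?_ (G.contractEdge u v) ((G.totalWeight_contractEdge huv).trans hG) rfl
      rw [← hN]
      classical
      refine lt_of_eq_of_lt (Fintype.card_congr (Equiv.refl {x : G.V // x ≠ v})) ?_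
      exact Fintype.card_subtype_lt (p := fun x => x ≠ v) (x := v) (by simp)
    rw [hrel, map_sub, map_sub, h1, h2]

end WeightedGraph

end Chromatic

/-! ### Products of power sums -/

noncomputable section PowerSums

theorem exists_equiv_of_map_eq {α β γ : Type*} [Fintype α] [Fintype β] (f : α → γ) (g : β → γ)
    (h : Finset.univ.val.map f = Finset.univ.val.map g) : ∃ e : α ≃ β, ∀ a, g (e a) = f a := by
  classical
  have hc : ∀ c, Nonempty ({a // f a = c} ≃ {b // g b = c}) := fun c => by
    rw [← Fintype.card_eq, Fintype.card_subtype, Fintype.card_subtype]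
    have := congrArg (Multiset.count c) h
    simpa only [Multiset.count_map, eq_comm (a := c), Finset.card_def, Finset.filter_val] using this
  exact ⟨Equiv.ofFiberEquiv fun c => (hc c).some, fun a => Equiv.ofFiberEquiv_map _ a⟩

theorem Multiset.exists_fin_map_eq {α : Type*} (s : Multiset α) :
    ∃ (k : ℕ) (w : Fin k → α), Finset.univ.val.map w = s := by
  induction s using Quotient.inductionOn with
  | _ l => exact ⟨l.length, l.get, by simp [Fin.univ_val_map]⟩

/-- If the exponent `∑ v, w v • κ v`, with distinct variables `κ v`, arises from the positive
numbers `w'` through some assignment `c` of variables, and there are at most as many `w'` as `w`,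
then the two families of numbers agree. -/
theorem map_eq_of_sum_single_eq {V V' σ : Type*} [Fintype V] [Fintype V'] {w : V → ℕ} {w' : V' → ℕ}
    (hw : ∀ v, w v ≠ 0) (hw' : ∀ v, w' v ≠ 0) {κ : V → σ} (hκ : Function.Injective κ)
    {c : V' → σ} (h : ∑ v, Finsupp.single (c v) (w' v) = ∑ v, Finsupp.single (κ v) (w v))
    (hcard : Fintype.card V' ≤ Fintype.card V) :
    Finset.univ.val.map w' = Finset.univ.val.map w := by
  classical
  have hval : ∀ s, ∑ v, (if c v = s then w' v else 0) = ∑ v, (if κ v = s then w v else 0) :=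
    fun s => by simpa [Finsupp.single_apply, Finsupp.finsetSum_apply] using DFunLike.congr_fun h s
  -- both sides involve the same variables, which gives a bijection `φ` between the index sets
  have hex : ∀ v', ∃ v, κ v = c v' := fun v' => by
    by_contra! hne
    have h1 := hval (c v')
    rw [Finset.sum_eq_zero (s := Finset.univ) (f := fun v => if κ v = c v' then w v else 0)
      (fun v _ => if_neg (hne v)), Finset.sum_eq_zero_iff] at h1
    exact hw' v' (by simpa using h1 v' (Finset.mem_univ _))
  choose φ hφ using hex
  have hsurj : Function.Surjective φ := fun v => by
    by_contra! hne
    have h1 := hval (κ v)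
    rw [Finset.sum_eq_zero (s := Finset.univ) (f := fun v' => if c v' = κ v then w' v' else 0)
      (fun v' _ => if_neg fun h => hne v' (hκ ((hφ v').trans h))), eq_comm,
      Finset.sum_eq_zero_iff] at h1
    exact hw v (by simpa using h1 v (Finset.mem_univ _))
  have hbij : Function.Bijective φ := (Fintype.bijective_iff_surjective_and_card φ).mpr
    ⟨hsurj, le_antisymm hcard (Fintype.card_le_of_surjective φ hsurj)⟩
  have hww : w' = w ∘ φ := funext fun v' => by
    have h1 := hval (c v')
    rw [Finset.sum_eq_single v', Finset.sum_eq_single (φ v')] at h1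
    · simpa [hφ] using h1
    · exact fun v _ hv => if_neg fun h => hv (hκ (h.trans (hφ v').symm))
    · simp
    · exact fun v _ hv => if_neg fun h => hv (hbij.1 (hκ (by rw [hφ, hφ, h])))
    · simp
  rw [hww, ← Multiset.map_map]
  exact congrArg _ (Multiset.map_univ_val_equiv (Equiv.ofBijective φ hbij))

open MvPolynomial

theorem coeff_prod_psum {R σ V : Type*} [Field R] [Fintype σ] [DecidableEq σ] [Fintype V]
    [DecidableEq V] (w : V → ℕ) (e : σ →₀ ℕ) :
    coeff e (∏ v, psum σ R (w v)) =
      (({c : V → σ | ∑ v, Finsupp.single (c v) (w v) = e} : Finset _).card : R) := by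
  have h : ∏ v, psum σ R (w v) =
      ∑ c : V → σ, monomial (∑ v, Finsupp.single (c v) (w v)) (1 : R) := by
    simp_rw [psum]
    rw [Fintype.prod_sum]
    refine Finset.sum_congr rfl fun c _ => ?_
    rw [monomial_sum_one]
    exact Finset.prod_congr rfl fun v _ => X_pow_eq_monomial
  rw [h, coeff_sum]
  simp [coeff_monomial, Finset.sum_boole]

theorem psumPart_eq_prod {R σ : Type*} [Field R] [Fintype σ] {d k : ℕ} (μ : d.Partition)
    (w : Fin k → ℕ) (hw : Finset.univ.val.map w = μ.parts) :
    psumPart σ R μ = ∏ v, psum σ R (w v) := by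
  rw [psumPart, ← hw, Multiset.map_map]
  rfl

/-- In `d` variables the products of power sums of degree `d` are linearly independent. In a linear
relation, take a partition `μ` with the largest number of parts: the monomial with exponents `μ`
occurs in no other product of power sums of the relation. -/
theorem psumPart_linearIndependent (R : Type*) [Field R] [CharZero R] (d : ℕ) :
    LinearIndependent R fun μ : d.Partition => psumPart (Fin d) R μ := by
  classical
  rw [Fintype.linearIndependent_iff]
  intro a ha
  by_contra! hne
  obtain ⟨μ, hμ, hmax⟩ := Finset.exists_max_image (Finset.univ.filter fun μ => a μ ≠ 0)
    (fun μ : d.Partition => μ.parts.card) (by simpa [Finset.Nonempty] using hne)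
  simp only [Finset.mem_filter, Finset.mem_univ, true_and] at hμ hmax
  obtain ⟨k, w, hw⟩ := μ.parts.exists_fin_map_eq
  have hcard : μ.parts.card = k := by rw [← hw]; simp
  have hpos : ∀ v, w v ≠ 0 := fun v =>
    (μ.parts_pos (by rw [← hw]; exact Multiset.mem_map_of_mem w (Finset.mem_univ_val v))).ne'
  have hkd : k ≤ d := by
    have h1 : ∑ v, w v = d := by rw [← μ.parts_sum, ← hw]; rfl
    calc k = ∑ _v : Fin k, 1 := by simp
      _ ≤ ∑ v, w v := Finset.sum_le_sum fun v _ => Nat.one_le_iff_ne_zero.mpr (hpos v)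
      _ = d := h1
  have hco := congrArg (coeff (∑ v, Finsupp.single (Fin.castLE hkd v) (w v))) ha
  rw [coeff_sum, coeff_zero, Finset.sum_eq_single μ] at hco
  · rw [coeff_smul, psumPart_eq_prod μ w hw, coeff_prod_psum, smul_eq_mul, mul_eq_zero,
      Nat.cast_eq_zero, Finset.card_eq_zero] at hco
    refine hco.elim hμ fun h => ?_
    exact Finset.notMem_empty (Fin.castLE hkd) (h ▸ by simp)
  · intro ν _ hνμ
    rw [coeff_smul, smul_eq_mul]
    by_cases hν : a ν = 0
    · rw [hν, zero_mul]
    obtain ⟨k', w', hw'⟩ := ν.parts.exists_fin_map_eq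
    have hcard' : ν.parts.card = k' := by rw [← hw']; simp
    have hpos' : ∀ v, w' v ≠ 0 := fun v =>
      (ν.parts_pos (by rw [← hw']; exact Multiset.mem_map_of_mem w' (Finset.mem_univ_val v))).ne'
    rw [psumPart_eq_prod ν w' hw', coeff_prod_psum, Finset.card_eq_zero.mpr, Nat.cast_zero,
      mul_zero]
    refine Finset.filter_eq_empty_iff.mpr fun c _ hc => hνμ (Nat.Partition.ext ?_)
    rw [← hw, ← hw']
    refine map_eq_of_sum_single_eq hpos hpos' (Fin.castLE_injective hkd) hc ?_
    have := hmax ν hν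
    rw [hcard, hcard'] at this
    simpa using this
  · simp

/-- The values of the products of power sums at points with nonzero coordinates span the space of
functions on the set of partitions of `d`. -/
theorem span_eval_psumPart_eq_top (R : Type*) [Field R] [CharZero R] (d : ℕ) :
    Submodule.span R (Set.range fun (l : {l : Fin d → R // ∀ i, l i ≠ 0}) (μ : d.Partition) =>
      eval l.1 (psumPart (Fin d) R μ)) = ⊤ := by
  by_contra htop
  obtain ⟨φ, hφ, hle⟩ := Submodule.exists_le_ker_of_lt_top _ (lt_top_iff_ne_top.mpr htop)
  apply hφ
  have hφ_apply : ∀ t, φ t = ∑ μ, t μ * φ (Pi.single μ 1) := fun t => by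
    conv_lhs => rw [← LinearMap.sum_single_apply (fun _ : d.Partition => R) t, map_sum]
    refine Finset.sum_congr rfl fun μ _ => ?_
    rw [← smul_eq_mul, ← map_smul, ← Pi.single_smul, smul_eq_mul, mul_one]
  -- a form that vanishes at all these vectors gives a polynomial that vanishes off the coordinate
  -- hyperplanes, hence is zero
  let q : MvPolynomial (Fin d) R := ∑ μ : d.Partition, φ (Pi.single μ 1) • psumPart (Fin d) R μ
  have hq : q * ∏ i, X i = 0 := by
    refine MvPolynomial.funext fun l => ?_
    rw [map_mul, map_zero, map_prod]
    by_cases hl : ∀ i, l i ≠ 0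
    · have h := hle (Submodule.subset_span ⟨⟨l, hl⟩, rfl⟩)
      rw [LinearMap.mem_ker, hφ_apply] at h
      have : eval l q = 0 := by
        rw [← h]
        simp only [q, map_sum, smul_eval]
        exact Finset.sum_congr rfl fun μ _ => mul_comm _ _
      rw [this, zero_mul]
    · push Not at hl
      obtain ⟨i, hi⟩ := hl
      rw [Finset.prod_eq_zero (Finset.mem_univ i) (by simpa using hi), mul_zero]
  have hq0 : q = 0 := (mul_eq_zero.mp hq).resolve_right
    (Finset.prod_ne_zero_iff.mpr fun i _ => X_ne_zero i)
  have h0 := Fintype.linearIndependent_iff.mp (psumPart_linearIndependent R d) _ hq0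
  refine LinearMap.ext fun t => ?_
  rw [hφ_apply]
  simp [h0]

/-- On graphs of total weight `d`, each linear form on the space of graphs is a linear combination
of weighted chromatic functions in `d` nonzero variables. -/
theorem WeightedGraph.exists_eq_sum_chromaticValue {R : Type*} [Field R] [CharZero R] (d : ℕ)
    (f : ChromaticSpace R →ₗ[R] R) :
    ∃ β : {l : Fin d → R // ∀ i, l i ≠ 0} →₀ R, ∀ G : WeightedGraph, G.totalWeight = d →
      f (G.toC R) = β.sum fun l a => a * G.chromaticValue l.1 := by
  classical
  -- the weights of the vertices of `G` form the partition `μ`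
  let P : WeightedGraph → d.Partition → Prop := fun G μ =>
    G.graph = ⊥ ∧ (@Finset.univ _ G.fintype).val.map (fun v => (G.weight v : ℕ)) = μ.parts
  -- the values of `f` on graphs without edges, as a function of the partition
  let t : d.Partition → R := fun μ => if h : ∃ G, P G μ then f (h.choose.toC R) else 0
  have ht : ∀ G μ, P G μ → t μ = f (G.toC R) := fun G μ hG => by
    have h : ∃ G, P G μ := ⟨G, hG⟩
    simp only [t, dif_pos h]
    obtain ⟨h1, h2⟩ := h.choose_spec
    let := h.choose.fintype
    let := G.fintype
    obtain ⟨e, he⟩ := exists_equiv_of_map_eq _ _ (h2.trans hG.2.symm)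
    congr 1
    rw [← sub_eq_zero]
    refine (Submodule.Quotient.mk_eq_zero _).mpr
      (Submodule.subset_span (ChromaticRelation.isomorphic _ _ ⟨⟨e, ?_⟩, fun v => PNat.eq (he v)⟩))
    intro x y
    rw [h1, hG.1]
    rfl
  have hmem : t ∈ Submodule.span R (Set.range fun (l : {l : Fin d → R // ∀ i, l i ≠ 0})
      (μ : d.Partition) => eval l.1 (psumPart (Fin d) R μ)) := by
    rw [span_eval_psumPart_eq_top]; trivial
  obtain ⟨β, hβ⟩ := Finsupp.mem_span_range_iff_exists_finsupp.mp hmem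
  refine ⟨β, fun G hG => ?_⟩
  let F : ChromaticSpace R →ₗ[R] R := β.sum fun l a => a • chromaticForm l.1
  have hF : ∀ G : WeightedGraph, F (G.toC R) = β.sum fun l a => a * G.chromaticValue l.1 :=
    fun G => by
      simp only [F, Finsupp.sum, LinearMap.sum_apply, LinearMap.smul_apply, chromaticForm_toC,
        smul_eq_mul]
  rw [← hF]
  refine map_eq_of_forall_bot f F (fun G hbot hG => ?_) G hG
  let := G.fintype
  let μ : d.Partition :=
    { parts := Finset.univ.val.map fun v => (G.weight v : ℕ)
      parts_pos := fun {i} hi => by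
        obtain ⟨v, -, rfl⟩ := Multiset.mem_map.mp hi
        exact (G.weight v).pos
      parts_sum := hG }
  rw [← ht G μ ⟨hbot, rfl⟩, hF, ← hβ, Finsupp.sum, Finset.sum_apply]
  refine Finset.sum_congr rfl fun l _ => ?_
  beta_reduce
  rw [Pi.smul_apply, smul_eq_mul, chromaticValue_of_eq_bot _ _ hbot]
  congr 1
  change eval l.1 ((Finset.univ.val.map fun v => (G.weight v : ℕ)).map (psum (Fin d) R)).prod = _
  rw [Multiset.map_map]
  change eval l.1 (∏ v, psum (Fin d) R (G.weight v)) = _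
  rw [map_prod]
  refine Finset.prod_congr rfl fun v _ => ?_
  simp [psum]

end PowerSums

/-! ### Chord diagrams span the space of diagrams -/

section ChordSpan

theorem SimpleGraph.Connected.of_surjective {α β : Type*} {G : SimpleGraph α} {H : SimpleGraph β}
    (hG : G.Connected) {f : α → β} (hf : Function.Surjective f)
    (h : ∀ x y, G.Adj x y → H.Adj (f x) (f y) ∨ f x = f y) : H.Connected := by
  have hreach : ∀ x y, G.Reachable x y → H.Reachable (f x) (f y) := fun x y hxy => by
    obtain ⟨p⟩ := hxy
    induction p with
    | nil => exact .refl _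
    | cons hadj _ ih =>
      rcases h _ _ hadj with h' | h'
      · exact h'.reachable.trans ih
      · rw [h']; exact ih
  have := hG.nonempty
  refine { preconnected := fun x y => ?_, nonempty := Nonempty.map f inferInstance }
  obtain ⟨x, rfl⟩ := hf x
  obtain ⟨y, rfl⟩ := hf y
  exact hreach x y (hG.preconnected x y)

namespace TrivalentDiagram

/-- Connectedness of a gluing passes to another one along a correspondence of edges, up to edges
whose ends become equal. -/
theorem connected_of_map {k m k' m' : ℕ} (D : TrivalentDiagram k m)
    (glue' : HalfEdge k' m' → HalfEdge k' m') {f : Option (Fin m) → Option (Fin m')}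
    (hf : Function.Surjective f)
    (h : ∀ x, (∃ y, HalfEdge.origin y = f (HalfEdge.origin x) ∧
      HalfEdge.origin (glue' y) = f (HalfEdge.origin (D.glue x))) ∨
        f (HalfEdge.origin x) = f (HalfEdge.origin (D.glue x))) :
    (SimpleGraph.fromRel fun x y : Option (Fin m') =>
      ∃ h, HalfEdge.origin h = x ∧ HalfEdge.origin (glue' h) = y).Connected := by
  refine D.connected.of_surjective hf fun x y hxy => ?_
  by_cases hne : f x = f y
  · exact Or.inr hne
  left
  rw [SimpleGraph.fromRel_adj] at hxy ⊢
  refine ⟨hne, hxy.2.imp ?_ ?_⟩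
  · rintro ⟨z, rfl, rfl⟩
    exact (h z).resolve_right hne
  · rintro ⟨z, rfl, rfl⟩
    exact (h z).resolve_right (Ne.symm hne)

/-- The diagram obtained by renaming the half-edges. -/
def rename {k m : ℕ} (D : TrivalentDiagram k m) (φ : HalfEdge k m ≃ HalfEdge k m)
    {f : Option (Fin m) → Option (Fin m)} (hf : Function.Surjective f)
    (hφ : ∀ h, HalfEdge.origin (φ h) = f (HalfEdge.origin h)) : TrivalentDiagram k m where
  glue h := φ (D.glue (φ.symm h))
  glue_glue h := by simp [D.glue_glue]
  glue_ne h := fun he => D.glue_ne (φ.symm h) <| by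
    rw [← φ.apply_eq_iff_eq, he, φ.apply_symm_apply]
  connected := D.connected_of_map _ hf fun x => Or.inl ⟨φ x, hφ x, by simp [hφ]⟩

/-- The opposite of (STU): an edge that joins the circle to an outer vertex can be resolved, if the
numbering is the one that is prescribed there. -/
theorem exists_stu {k m : ℕ} (S : TrivalentDiagram (k + 1) (m + 1))
    (h0 : S.glue (Sum.inl (Fin.last k)) = Sum.inr (Fin.last m, 0)) :
    ∃ T U : TrivalentDiagram (k + 2) m, STU S T U := by
  have h0' : S.glue (Sum.inr (Fin.last m, 0)) = Sum.inl (Fin.last k) := by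
    rw [← h0, S.glue_glue]
  have hex : ∀ h, ∃ h', S.glue (HalfEdge.resolve 2 1 h) = HalfEdge.resolve 2 1 h' := fun h => by
    obtain ⟨x, hx⟩ := (stuEquiv k m).surjective (S.glue (HalfEdge.resolve 2 1 h))
    have hS : S.glue (stuEquiv k m x) = stuEquiv k m (Sum.inl h) := by
      rw [hx, S.glue_glue, stuEquiv_inl]
    rcases x with x | (_ | _)
    · exact ⟨x, hx.symm⟩
    · have : stuEquiv k m (Sum.inr true) = stuEquiv k m (Sum.inl h) := h0'.symm.trans hS
      exact absurd ((stuEquiv k m).injective this) (by simp)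
    · have : stuEquiv k m (Sum.inr false) = stuEquiv k m (Sum.inl h) := h0.symm.trans hS
      exact absurd ((stuEquiv k m).injective this) (by simp)
  choose t ht using hex
  -- the removed vertex is merged into the circle
  let f : Option (Fin (m + 1)) → Option (Fin m) := fun x =>
    x.elim none (Fin.lastCases none some)
  have hf : Function.Surjective f := fun x => by
    cases x with
    | none => exact ⟨none, rfl⟩
    | some v => exact ⟨some v.castSucc, by simp [f]⟩
  have hfo : ∀ h : HalfEdge (k + 2) m, f (HalfEdge.origin (HalfEdge.resolve 2 1 h)) =
      HalfEdge.origin h := by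
    rintro (i | p)
    · induction i using Fin.lastCases with
      | last => simp [f, HalfEdge.resolve, HalfEdge.origin]
      | cast i =>
        induction i using Fin.lastCases with
        | last => simp [f, HalfEdge.resolve, HalfEdge.origin]
        | cast i => simp [f, HalfEdge.resolve, HalfEdge.origin]
    · simp [f, HalfEdge.resolve, HalfEdge.origin]
  let T : TrivalentDiagram (k + 2) m :=
    { glue := t
      glue_glue := fun h => HalfEdge.resolve_injective <| by rw [← ht, ← ht, S.glue_glue]
      glue_ne := fun h he => S.glue_ne (HalfEdge.resolve 2 1 h) <| by rw [ht, he]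
      connected := S.connected_of_map t hf fun x => by
        obtain ⟨x, rfl⟩ := (stuEquiv k m).surjective x
        rcases x with x | (_ | _)
        · left
          exact ⟨x, by rw [stuEquiv_inl, hfo], by rw [stuEquiv_inl, ht, hfo]⟩
        · right
          change f (some (Fin.last m)) = f (HalfEdge.origin (S.glue (Sum.inr (Fin.last m, 0))))
          rw [h0']
          simp [f, HalfEdge.origin]
        · right
          change f none = f (HalfEdge.origin (S.glue (Sum.inl (Fin.last k))))
          rw [h0]
          simp [f, HalfEdge.origin] }
  have hswap : ∀ h, stuSwap k m (stuSwap k m h) = h := by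
    rintro (i | p) <;> simp [stuSwap]
  have hsymm : (stuSwap k m).symm = stuSwap k m := Equiv.ext fun h => by
    rw [Equiv.symm_apply_eq, hswap]
  refine ⟨T, T.rename (stuSwap k m) (f := id) Function.surjective_id ?_, h0, ht, fun h => ?_⟩
  · rintro (i | p) <;> rfl
  · change _ = HalfEdge.resolve 1 2 (stuSwap k m (T.glue ((stuSwap k m).symm h)))
    rw [hsymm, ← resolve_stuSwap, ← resolve_stuSwap, hswap]
    exact ht _

theorem exists_finRotate_pow_eq_last {k : ℕ} (i : Fin (k + 1)) :
    ∃ r : ℕ, (finRotate (k + 1) ^ r : Equiv.Perm _) i = Fin.last k := by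
  have h : ∀ r : ℕ, ((finRotate (k + 1) ^ r : Equiv.Perm _) i).val = (i.val + r) % (k + 1) :=
    fun r => by
      induction r with
      | zero => simp [Nat.mod_eq_of_lt i.2]
      | succ r ih =>
        rw [pow_succ', Equiv.Perm.mul_apply, finRotate_apply, Fin.val_add, ih, Fin.val_one',
          ← Nat.add_mod, add_assoc]
  refine ⟨k - i.val, Fin.ext ?_⟩
  have := i.2
  rw [h, Fin.val_last, Nat.add_sub_cancel' (by omega), Nat.mod_eq_of_lt (by omega)]

/-- Since diagrams are connected, one with outer vertices is equivalent to one to which (STU) can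
be applied. -/
theorem exists_equivalent_glue_last {k m : ℕ} (D : TrivalentDiagram k (m + 1)) :
    ∃ (k' : ℕ) (hk : k = k' + 1) (S : TrivalentDiagram (k' + 1) (m + 1)),
      (hk ▸ D).Equivalent S ∧ S.glue (Sum.inl (Fin.last k')) = Sum.inr (Fin.last m, 0) := by
  -- an edge between the circle and an outer vertex
  obtain ⟨i, p, hip⟩ : ∃ i p, D.glue (Sum.inl i) = Sum.inr p := by
    obtain ⟨w⟩ := D.connected.preconnected none (some (Fin.last m))
    obtain ⟨x, -, h1, h2⟩ := w.exists_boundary_dart {none} rfl (by simp)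
    have hadj := (SimpleGraph.fromRel_adj _ _ _).mp x.adj
    rw [Set.mem_singleton_iff] at h1 h2
    have key : ∀ y z, HalfEdge.origin y = none → HalfEdge.origin z ≠ none → D.glue y = z →
        ∃ i p, D.glue (Sum.inl i) = Sum.inr p := by
      rintro (i | y) (j | p) hy hz h
      · exact absurd rfl hz
      · exact ⟨i, p, h⟩
      · exact absurd hy (by simp [HalfEdge.origin])
      · exact absurd hy (by simp [HalfEdge.origin])
    rcases hadj.2 with ⟨y, hy1, hy2⟩ | ⟨y, hy1, hy2⟩
    · exact key y _ (hy1.trans h1) (by rw [hy2]; exact h2) rfl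
    · exact key (D.glue y) y (hy2.trans h1) (by rw [hy1]; exact h2) (D.glue_glue y)
  obtain ⟨v, t⟩ := p
  cases k with
  | zero => exact i.elim0
  | succ k =>
    obtain ⟨r, hr⟩ := exists_finRotate_pow_eq_last i
    let e := Equiv.swap v (Fin.last m)
    let φ := Equiv.ofBijective _ (HalfEdge.relabel_bijective (k := k + 1) r e fun _ => -t)
    have hsurj : Function.Surjective (Option.map e) := fun x => ⟨x.map e.symm, by simp⟩
    refine ⟨k, rfl, D.rename φ hsurj ?_, ⟨r, e, fun _ => -t, fun h => ?_⟩, ?_⟩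
    · rintro (i | p) <;> rfl
    · change φ (D.glue (φ.symm (φ h))) = φ (D.glue h)
      rw [φ.symm_apply_apply]
    · have hi : φ (Sum.inl i) = Sum.inl (Fin.last k) := congrArg Sum.inl hr
      change φ (D.glue (φ.symm (Sum.inl (Fin.last k)))) = _
      rw [← hi, φ.symm_apply_apply, hip]
      change Sum.inr (e v, t + -t) = _
      rw [add_neg_cancel, Equiv.swap_apply_left]

theorem toA_eq_of_equivalent (R : Type*) [Field R] {k m : ℕ} {D D' : TrivalentDiagram k m}
    (h : D.Equivalent D') : D.toA R = D'.toA R := by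
  rw [← sub_eq_zero]
  exact (Submodule.Quotient.mk_eq_zero _).mpr
    (Submodule.subset_span (DiagramRelation.equivalent D D' h))

theorem toA_eq_of_stu (R : Type*) [Field R] {k m : ℕ} {S : TrivalentDiagram (k + 1) (m + 1)}
    {T U : TrivalentDiagram (k + 2) m} (h : STU S T U) : S.toA R = T.toA R - U.toA R := by
  rw [← sub_eq_zero]
  exact (Submodule.Quotient.mk_eq_zero _).mpr
    (Submodule.subset_span (DiagramRelation.stu S T U h))

theorem exists_eq_toTrivalent {d : ℕ} (D : TrivalentDiagram (2 * d) 0) :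
    ∃ C : ChordDiagram d, C.toTrivalent = D := by
  have hex : ∀ i, ∃ j, D.glue (Sum.inl i) = Sum.inl j := fun i => by
    rcases D.glue (Sum.inl i) with j | p
    · exact ⟨j, rfl⟩
    · exact p.1.elim0
  choose c hc using hex
  let C : ChordDiagram d :=
    { partner := c
      partner_partner := fun i => Sum.inl_injective (β := Fin 0 × Fin 3) <| by
        rw [← hc, ← hc, D.glue_glue]
      partner_ne := fun i h => D.glue_ne (Sum.inl i) (by rw [hc, h]) }
  have hglue : C.toTrivalent.glue = D.glue := by
    funext h
    rcases h with i | p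
    · exact (hc i).symm
    · exact p.1.elim0
  refine ⟨C, ?_⟩
  generalize C.toTrivalent = E at hglue
  cases D
  cases E
  congr

/-- Outer vertices can be removed one after the other by (STU). -/
theorem toA_mem_span_chordDiagram (R : Type*) [Field R] {d k m : ℕ} (hkm : k + m = 2 * d)
    (D : TrivalentDiagram k m) :
    D.toA R ∈ Submodule.span R (Set.range fun C : ChordDiagram d => C.toTrivalent.toA R) := by
  induction m generalizing k with
  | zero =>
    obtain rfl : k = 2 * d := hkm
    obtain ⟨C, rfl⟩ := D.exists_eq_toTrivalent
    exact Submodule.subset_span ⟨C, rfl⟩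
  | succ m ih =>
    obtain ⟨k, rfl, S, hDS, hS⟩ := D.exists_equivalent_glue_last
    obtain ⟨T, U, hSTU⟩ := S.exists_stu hS
    rw [toA_eq_of_equivalent R hDS, toA_eq_of_stu R hSTU]
    exact Submodule.sub_mem _ (ih (by omega) T) (ih (by omega) U)

end TrivalentDiagram

/-- Weight systems are determined by their values on chord diagrams. -/
theorem weightSystem_ext {R : Type*} [Field R] {d : ℕ} {w w' : WeightSystem R d}
    (h : ∀ D : ChordDiagram d, w (D.toA R) = w' (D.toA R)) : w = w' := by
  have hle : homogeneousPart R d ≤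
      (LinearMap.eqLocus w w').map (homogeneousPart R d).subtype := by
    conv_lhs => rw [homogeneousPart]
    rw [Submodule.span_le]
    rintro _ ⟨k, m, D, hkm, rfl⟩
    refine Submodule.span_le.mpr ?_ (D.toA_mem_span_chordDiagram R hkm)
    rintro _ ⟨C, rfl⟩
    exact ⟨C.toA R, h C, rfl⟩
  refine LinearMap.ext fun x => ?_
  obtain ⟨y, hy, hyx⟩ := hle x.2
  rw [← Subtype.ext hyx]
  exact hy

end ChordSpan

/-! ### Chromatic weight systems -/

section ChromaticWeightSystems

attribute [local instance] WeightedGraph.fintype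

variable {R : Type*} [Field R]

/-- The coefficient of `n ^ N` of a polynomial in `n` of degree at most `N` is a linear combination
of its values at `1, …, N + 1`. -/
theorem exists_sum_mul_pow_eq [CharZero R] (N : ℕ) : ∃ α : Fin (N + 1) → R, ∀ k, k ≤ N →
    ∑ j, α j * ((j.1 + 1 : ℕ) : R) ^ k = if k = N then 1 else 0 := by
  let v : Fin (N + 1) → R := fun j => ((j.1 + 1 : ℕ) : R)
  have hdet : IsUnit (Matrix.vandermonde v).det :=
    (Matrix.det_vandermonde_ne_zero_iff.mpr fun i j hij => Fin.ext <| by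
      simpa [v] using hij).isUnit
  refine ⟨Matrix.vecMul (Pi.single (Fin.last N) 1) (Matrix.vandermonde v)⁻¹, fun k hk => ?_⟩
  have h : Matrix.vecMul (Matrix.vecMul (Pi.single (Fin.last N) 1) (Matrix.vandermonde v)⁻¹)
      (Matrix.vandermonde v) = Pi.single (Fin.last N) 1 := by
    rw [Matrix.vecMul_vecMul, Matrix.nonsing_inv_mul _ hdet, Matrix.vecMul_one]
  have h' := congrFun h ⟨k, Nat.lt_succ_of_le hk⟩
  rw [Pi.single_apply] at h'
  refine Eq.trans ?_ (h'.trans (if_congr (by simp [Fin.ext_iff]) rfl rfl))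
  rfl

theorem ChordDiagram.totalWeight_weightedGraph {d : ℕ} (D : ChordDiagram d) :
    D.weightedGraph.totalWeight = d := by
  refine Eq.trans ?_ D.card_chord
  change ∑ _a : D.Chord, ((1 : ℕ+) : ℕ) = _
  simp

/-- The coefficient of `n ^ (2 * d)` in the sum over states is the chromatic function of the
intersection graph. -/
theorem ChordDiagram.sum_states_eq_chromaticValue {d : ℕ} (D : ChordDiagram d) (l : Fin d → R)
    (ε : R) :
    ∑ σ : D.Chord → Fin d × Bool, (∏ a, l (σ a).1 * if (σ a).2 then ε else 1) *
      (if D.loops σ = 2 * d then 1 else 0) = D.weightedGraph.chromaticValue l := by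
  classical
  have h1 : D.weightedGraph.chromaticValue l = ∑ c : D.Chord → Fin d,
      if D.IsProper c then ∏ a, l (c a) else 0 := by
    let e : (D.weightedGraph.V → Fin d) ≃ (D.Chord → Fin d) := Equiv.refl _
    let e' : D.weightedGraph.V ≃ D.Chord := Equiv.refl _
    unfold WeightedGraph.chromaticValue
    refine Fintype.sum_equiv e _ _ fun c => ?_
    have hprop : (∀ x y, D.weightedGraph.graph.Adj x y → c x ≠ c y) ↔ D.IsProper (e c) := Iff.rfl
    have hprod : ∏ v, l (c v) ^ (D.weightedGraph.weight v : ℕ) = ∏ a, l (e c a) := by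
      refine Fintype.prod_equiv e' _ _ fun a => ?_
      change l (c a) ^ ((1 : ℕ+) : ℕ) = l (c a)
      rw [PNat.one_coe, pow_one]
    simp only [hprop, hprod]
  rw [h1]
  have hinj : Function.Injective fun (c : D.Chord → Fin d) a => (c a, false) := fun c c' h =>
    funext fun a => congrArg Prod.fst (congrFun h a)
  refine (Finset.sum_of_injOn _ hinj.injOn (by simp) (fun σ _ hσ => ?_) fun c _ => ?_).symm
  · rw [if_neg, mul_zero]
    rw [D.loops_eq_iff]
    rintro ⟨h, -⟩
    exact hσ ⟨fun a => (σ a).1, by simp, funext fun a => Prod.ext rfl (h a).symm⟩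
  · simp [D.loops_eq_iff]

/-- For nonzero `l`, the chromatic function of intersection graphs extends to a linear combination
of weight systems of Lie algebras of the given type. -/
theorem exists_mem_span_chromaticValue [CharZero R] {d : ℕ} {g : ℕ → Type*} [∀ n, LieRing (g n)]
    [∀ n, LieAlgebra R (g n)] [∀ n, Module.Finite R (g n)]
    {τ : ∀ n, g n →ₗ⁅R⁆ Module.End R (Fin n → R)} {ε : R} {B : ∀ n, LinearMap.BilinForm R (g n)}
    {F : ∀ n, Fin n → Fin n → g n} (hB : ∀ n, IsEntryForm (τ n) ε (B n) (F n)) (l : Fin d → R)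
    (hl : ∀ i, l i ≠ 0) :
    ∃ w ∈ Submodule.span R {w' : WeightSystem R d |
        ∃ n : ℕ, 1 ≤ n ∧ IsLieWeightSystem (tensorPowerRep (τ n) d) w'},
      ∀ D : ChordDiagram d, w (D.toA R) = D.weightedGraph.chromaticValue l := by
  choose k C hC using fun n => (hB n).exists_casimirTensor_eq l hl
  choose w hw using fun n => exists_weightSystem_lieWeight (C n) (tensorPowerRep (τ n) d) d
  obtain ⟨α, hα⟩ := exists_sum_mul_pow_eq (R := R) (2 * d)
  refine ⟨∑ j, α j • w (j.1 + 1), Submodule.sum_mem _ fun j _ => Submodule.smul_mem _ _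
    (Submodule.subset_span ⟨j.1 + 1, Nat.le_add_left 1 _, _, _, _, C _, hw _⟩), fun D => ?_⟩
  rw [← D.sum_states_eq_chromaticValue l ε]
  simp only [LinearMap.sum_apply, LinearMap.smul_apply, smul_eq_mul, hw,
    lieWeight_eq_sum_states (hC _), Finset.mul_sum]
  rw [Finset.sum_comm]
  refine Finset.sum_congr rfl fun σ _ => ?_
  rw [← hα _ (D.loops_le σ), Finset.mul_sum]
  exact Finset.sum_congr rfl fun j _ => by ring

/-- The linear form `f` through which `w` factors is a combination of chromatic functions in `l`,
and each of these lies in the span. -/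
theorem IsChromatic.mem_span [CharZero R] {d : ℕ} {w : WeightSystem R d} (hw : IsChromatic w)
    {g : ℕ → Type*} [∀ n, LieRing (g n)]
    [∀ n, LieAlgebra R (g n)] [∀ n, Module.Finite R (g n)]
    {τ : ∀ n, g n →ₗ⁅R⁆ Module.End R (Fin n → R)} {ε : R} {B : ∀ n, LinearMap.BilinForm R (g n)}
    {F : ∀ n, Fin n → Fin n → g n} (hB : ∀ n, IsEntryForm (τ n) ε (B n) (F n)) :
    w ∈ Submodule.span R {w' : WeightSystem R d |
        ∃ n : ℕ, 1 ≤ n ∧ IsLieWeightSystem (tensorPowerRep (τ n) d) w'} := by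
  obtain ⟨f, hf⟩ := hw
  obtain ⟨β, hβ⟩ := WeightedGraph.exists_eq_sum_chromaticValue d f
  choose v hv hvD using fun l : {l : Fin d → R // ∀ i, l i ≠ 0} =>
    exists_mem_span_chromaticValue hB l.1 l.2
  have hw : w = β.sum fun l a => a • v l := weightSystem_ext fun D => by
    rw [hf, hβ _ D.totalWeight_weightedGraph]
    simp only [Finsupp.sum, LinearMap.sum_apply, LinearMap.smul_apply, hvD, smul_eq_mul]
  rw [hw]
  exact Submodule.sum_mem _ fun l _ => Submodule.smul_mem _ _ (hv l)

end ChromaticWeightSystems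

theorem mainTheorem1 (R : Type*) [Field R] [CharZero R] (d : ℕ)
    (w : WeightSystem R d) (hw : IsChromatic w) :
    w ∈ Submodule.span R {w' : WeightSystem R d |
        ∃ n : ℕ, 1 ≤ n ∧ IsLieWeightSystem (tensorPowerRep (glRep R n) d) w'} ∧
    w ∈ Submodule.span R {w' : WeightSystem R d |
        ∃ n : ℕ, 1 ≤ n ∧ IsLieWeightSystem (tensorPowerRep (soRep R n) d) w'} :=
  ⟨hw.mem_span (glRep_isEntryForm R), hw.mem_span (soRep_isEntryForm R)⟩
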